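/- Let $S_0,S_1,S_2$ be closed (compact connected) Riemann surfaces and let $\beta_1:S_1\to S_0$, $\beta_2:S_2\to S_0$ be non-constant holomorphic maps. Let $B\subset S_0$ be the finite set of points that are a branch value (image of a critical point) of $\beta_1$ or of $\beta_2$, and put $S_0^*=S_0\setminus B$, $S_j^*=S_j\setminus\beta_j^{-1}(B)$ for $j=1,2$. The fiber product of the pairs $(S_1,\beta_1)$, $(S_2,\beta_2)$ is $$S_1\times_{(\beta_1,\beta_2)}S_2=\{(z_1,z_2)\in S_1\times S_2:\ \beta_1(z_1)=\beta_2(z_2)\}.$$ Its part lying over $S_0^*$, that is $\{(z_1,z_2)\in S_1^*\times S_2^*:\ \beta_1(z_1)=\beta_2(z_2)\}$, is a one-dimensional complex submanifold of $S_1\times S_2$; let $T_1,\dots,T_n$ be its connected components. An irreducible component of the fiber product is a closed Riemann surface obtained from some $T_k$ by adding finitely many points, i.e. a closed Riemann surface $R$ together with a holomorphic open embedding $T_k\to R$ whose image has finite complement. A map $\beta_j$ is called a regular (Galois) branched cover if its deck group, the group of the biholomorphic automorphisms $\varphi$ of $S_j$ with $\beta_j\circ\varphi=\beta_j$, acts transitively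 on each fiber of $\beta_j$. (1) If $\beta_1$ or $\beta_2$ is a regular branched cover, then every $T_k$ has such a completion to a closed Riemann surface, and all irreducible components of $S_1\times_{(\beta_1,\beta_2)}S_2$ are isomorphic (biholomorphic) closed Riemann surfaces. (2) (Group form.) Let $U$ be a simply connected Riemann surface (for instance the hyperbolic plane $\mathbb H^2$), let $\Gamma_0$ be a group acting freely and properly discontinuously on $U$ by holomorphic automorphisms (for $U=\mathbb H^2$: a torsion-free Fuchsian group), and let $p_0:U\to S_0^*$ be a holomorphic covering map whose fibers are the $\Gamma_0$-orbits, so that $S_0^*\cong U/\Gamma_0$. Let $\Gamma_1,\Gamma_2$ be subgroups of $\Gamma_0$ realizing the coverings $\beta_j:S_j^*\to S_0^*$, that is, for $j=1,2$ there is a holomorphic covering map $p_j:U\to S_j^*$ whose fibers are the $\Gamma_j$-orbits and such that $\beta_j\circ p_j=p_0$. If $\Gamma_1$ or $\Gamma_2$ is normal in $\Gamma_0$, then $T_1,\dots,T_n$ are pairwise isomorphic (biholomorphic) Riemann surfaces. -/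

import Mathlib

open scoped Manifold Topology

universe u₀ u₁ u₂ v v' w w'

/-- A Riemann surface: a connected Hausdorff one-dimensional complex manifold (charts in `ℂ` with
continuously complex-differentiable, that is holomorphic, coordinate changes). -/
class RiemannSurface (S : Type*) [TopologicalSpace S] [ChartedSpace ℂ S] : Prop extends
    IsManifold 𝓘(ℂ, ℂ) 1 S, T2Space S, ConnectedSpace S

/-- A closed Riemann surface: a compact (connected) Riemann surface. -/
class ClosedRiemannSurface (S : Type*) [TopologicalSpace S] [ChartedSpace ℂ S] : Prop extends
    RiemannSurface S, CompactSpace S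

/-- Holomorphic maps between one-dimensional complex manifolds. -/
structure HolomorphicMap (X Y : Type*) [TopologicalSpace X] [ChartedSpace ℂ X]
    [TopologicalSpace Y] [ChartedSpace ℂ Y] where
  /-- The underlying function. -/
  toFun : X → Y
  holomorphic : MDifferentiable 𝓘(ℂ, ℂ) 𝓘(ℂ, ℂ) toFun

instance {X Y : Type*} [TopologicalSpace X] [ChartedSpace ℂ X]
    [TopologicalSpace Y] [ChartedSpace ℂ Y] :
    CoeFun (HolomorphicMap X Y) (fun _ => X → Y) := ⟨HolomorphicMap.toFun⟩

section Basic

variable {X Y : Type*} [TopologicalSpace X] [ChartedSpace ℂ X]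
  [TopologicalSpace Y] [ChartedSpace ℂ Y]

/-- A map is non-constant. -/
def HolomorphicMap.Nonconstant (β : HolomorphicMap X Y) : Prop := ¬ ∃ c, ∀ x, β x = c

/-- The critical points of `β`: the points at which its derivative vanishes. -/
def HolomorphicMap.criticalPoints (β : HolomorphicMap X Y) : Set X :=
  {x | mfderiv 𝓘(ℂ, ℂ) 𝓘(ℂ, ℂ) β x = 0}

/-- The branch values of `β`: the images of the critical points. -/
def HolomorphicMap.branchValues (β : HolomorphicMap X Y) : Set Y := β '' β.criticalPoints

/-- A homeomorphism that is holomorphic together with its inverse. -/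
def IsBiholomorphism (φ : X ≃ₜ Y) : Prop :=
  MDifferentiable 𝓘(ℂ, ℂ) 𝓘(ℂ, ℂ) φ ∧ MDifferentiable 𝓘(ℂ, ℂ) 𝓘(ℂ, ℂ) φ.symm

variable (X Y) in
/-- `X` and `Y` are isomorphic (biholomorphically equivalent). -/
def Biholomorphic : Prop := ∃ φ : X ≃ₜ Y, IsBiholomorphism φ

/-- `β` is a regular (Galois) branched cover: it is non-constant and its deck group, the group of
the biholomorphic automorphisms `φ` of `X` with `β ∘ φ = β`, acts transitively on every fibre. -/
def IsRegularBranchedCover (β : HolomorphicMap X Y) : Prop :=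
  β.Nonconstant ∧ ∀ x y, β x = β y →
    ∃ φ : X ≃ₜ X, IsBiholomorphism φ ∧ (∀ z, β (φ z) = β z) ∧ φ x = y

variable (X Y) in
/-- `Y` is a compactification of `X` by finitely many punctures: `X` embeds holomorphically onto
the complement of a finite subset of `Y`. -/
def IsPunctureCompactification : Prop :=
  ∃ ι : X → Y, Topology.IsOpenEmbedding ι ∧ MDifferentiable 𝓘(ℂ, ℂ) 𝓘(ℂ, ℂ) ι ∧ (Set.range ι)ᶜ.Finite

/-- `p` realizes the subset `V` of `Y` as the quotient `X / G`: the group `G` acts on `X` freely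
and properly discontinuously by holomorphic automorphisms, and `p` is a holomorphic covering map
of `X` onto `V` whose fibres are the `G`-orbits. -/
def RealizesQuotient (G : Type*) [Group G] [MulAction G X] (p : HolomorphicMap X Y) (V : Set Y) :
    Prop :=
  (∀ g : G, MDifferentiable 𝓘(ℂ, ℂ) 𝓘(ℂ, ℂ) (fun x : X => g • x)) ∧
    ∃ hV : ∀ x, p x ∈ V, IsQuotientCoveringMap (V.codRestrict p hV) G

/-- A point at which the derivative of a coordinate expression vanishes is critical. -/
theorem HolomorphicMap.mem_criticalPoints_of_deriv (β : HolomorphicMap X Y) {x : X}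
    (h0 : deriv (chartAt ℂ (β x) ∘ β ∘ (chartAt ℂ x).symm) (chartAt ℂ x x) = 0) :
    x ∈ β.criticalPoints := by
  have hmd : MDifferentiableAt 𝓘(ℂ, ℂ) 𝓘(ℂ, ℂ) β x := β.holomorphic x
  have : mfderiv 𝓘(ℂ, ℂ) 𝓘(ℂ, ℂ) β x =
      fderiv ℂ (chartAt ℂ (β x) ∘ β ∘ (chartAt ℂ x).symm) (chartAt ℂ x x) := by
    simp only [mfderiv, hmd]
    simp [writtenInExtChartAt, extChartAt, Function.comp_def]
    rfl
  show mfderiv 𝓘(ℂ, ℂ) 𝓘(ℂ, ℂ) β x = 0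
  rw [this]
  ext
  exact (fderiv_apply_one_eq_deriv).trans h0

/-- The set of critical points of a holomorphic map is closed. -/
theorem HolomorphicMap.isClosed_criticalPoints [IsManifold 𝓘(ℂ, ℂ) 1 X]
    [IsManifold 𝓘(ℂ, ℂ) 1 Y] (β : HolomorphicMap X Y) : IsClosed β.criticalPoints := by
  rw [← isOpen_compl_iff, isOpen_iff_mem_nhds]
  intro x hx
  set φ := chartAt ℂ x with hφ
  set ψ := chartAt ℂ (β x) with hψ
  have hβc : Continuous β := β.holomorphic.continuous
  set V : Set ℂ := φ.target ∩ φ.symm ⁻¹' (β ⁻¹' ψ.source) with hV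
  have hVo : IsOpen V := φ.isOpen_inter_preimage_symm (ψ.open_source.preimage hβc)
  have hxV : φ x ∈ V := by
    refine ⟨mem_chart_target ℂ x, ?_⟩
    simp [hφ, hψ]
  set g : ℂ → ℂ := ψ ∘ β ∘ φ.symm with hg
  have h1 : MDifferentiableOn 𝓘(ℂ, ℂ) 𝓘(ℂ, ℂ) φ.symm φ.target :=
    mdifferentiableOn_atlas_symm (chart_mem_atlas ℂ x)
  have h2 : MDifferentiableOn 𝓘(ℂ, ℂ) 𝓘(ℂ, ℂ) ψ ψ.source :=
    mdifferentiableOn_atlas (chart_mem_atlas ℂ (β x))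
  have hgd : DifferentiableOn ℂ g V := by
    rw [← mdifferentiableOn_iff_differentiableOn]
    have h3 : MDifferentiableOn 𝓘(ℂ, ℂ) 𝓘(ℂ, ℂ) (β ∘ φ.symm) V :=
      β.holomorphic.comp_mdifferentiableOn (h1.mono Set.inter_subset_left)
    exact h2.comp h3 (fun z hz => hz.2)
  have hder : deriv g (φ x) ≠ 0 := fun h0 => hx (β.mem_criticalPoints_of_deriv h0)
  have hcont : ContinuousAt (deriv g) (φ x) :=
    (hgd.analyticAt (hVo.mem_nhds hxV)).deriv.continuousAt
  have hφx : ContinuousAt φ x := φ.continuousAt (mem_chart_source ℂ x)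
  have hne : ∀ᶠ z in 𝓝 x, deriv g (φ z) ≠ 0 :=
    (hcont.comp_of_eq hφx rfl).eventually_ne hder
  filter_upwards [hne, hφx.preimage_mem_nhds (hVo.mem_nhds hxV),
    φ.open_source.mem_nhds (mem_chart_source ℂ x)] with z hz hzV hzφ hzc
  apply hz
  have hzV' : φ z ∈ V := hzV
  have hzs : φ.symm (φ z) = z := φ.left_inv hzφ
  have d1 : MDifferentiableAt 𝓘(ℂ, ℂ) 𝓘(ℂ, ℂ) φ.symm (φ z) :=
    h1.mdifferentiableAt (φ.open_target.mem_nhds hzV'.1)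
  have d2 : MDifferentiableAt 𝓘(ℂ, ℂ) 𝓘(ℂ, ℂ) β (φ.symm (φ z)) := β.holomorphic _
  have d3 : MDifferentiableAt 𝓘(ℂ, ℂ) 𝓘(ℂ, ℂ) ψ (β (φ.symm (φ z))) :=
    h2.mdifferentiableAt (ψ.open_source.mem_nhds hzV'.2)
  have e0 : mfderiv 𝓘(ℂ, ℂ) 𝓘(ℂ, ℂ) β (φ.symm (φ z)) = 0 := by
    have : φ.symm (φ z) ∈ β.criticalPoints := by rw [hzs]; exact hzc
    exact this
  have e1 : mfderiv 𝓘(ℂ, ℂ) 𝓘(ℂ, ℂ) g (φ z) = 0 := by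
    have d23 := d2.comp (φ z) d1
    rw [hg, mfderiv_comp (φ z) d3 d23, mfderiv_comp (φ z) d2 d1, e0]
    ext
    simp
  rw [mfderiv_eq_fderiv] at e1
  rw [← fderiv_apply_one_eq_deriv]
  exact congrArg (fun L : ℂ →L[ℂ] ℂ => L 1) e1

/-- Inverse function theorem: off its critical points, a holomorphic map is a local
homeomorphism. -/
theorem HolomorphicMap.exists_localInverse [IsManifold 𝓘(ℂ, ℂ) 1 X] [IsManifold 𝓘(ℂ, ℂ) 1 Y]
    (β : HolomorphicMap X Y) {x : X} (hx : x ∉ β.criticalPoints) :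
    ∃ e : OpenPartialHomeomorph X Y, x ∈ e.source ∧ Set.EqOn β e e.source := by
  set φ := chartAt ℂ x with hφ
  set ψ := chartAt ℂ (β x) with hψ
  have hβc : Continuous β := β.holomorphic.continuous
  set V : Set ℂ := φ.target ∩ φ.symm ⁻¹' (β ⁻¹' ψ.source) with hV
  have hVo : IsOpen V := φ.isOpen_inter_preimage_symm (ψ.open_source.preimage hβc)
  have hxV : φ x ∈ V := by
    refine ⟨mem_chart_target ℂ x, ?_⟩
    simp [hφ, hψ]
  set g : ℂ → ℂ := ψ ∘ β ∘ φ.symm with hg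
  have hgd : DifferentiableOn ℂ g V := by
    rw [← mdifferentiableOn_iff_differentiableOn]
    have h1 : MDifferentiableOn 𝓘(ℂ, ℂ) 𝓘(ℂ, ℂ) φ.symm φ.target :=
      mdifferentiableOn_atlas_symm (chart_mem_atlas ℂ x)
    have h2 : MDifferentiableOn 𝓘(ℂ, ℂ) 𝓘(ℂ, ℂ) ψ ψ.source :=
      mdifferentiableOn_atlas (chart_mem_atlas ℂ (β x))
    have h3 : MDifferentiableOn 𝓘(ℂ, ℂ) 𝓘(ℂ, ℂ) (β ∘ φ.symm) V :=
      β.holomorphic.comp_mdifferentiableOn (h1.mono Set.inter_subset_left)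
    exact h2.comp h3 (fun z hz => hz.2)
  have han : AnalyticAt ℂ g (φ x) := hgd.analyticAt (hVo.mem_nhds hxV)
  have hder : deriv g (φ x) ≠ 0 := fun h0 => hx (β.mem_criticalPoints_of_deriv h0)
  have hs : HasStrictDerivAt g (deriv g (φ x)) (φ x) := han.hasStrictDerivAt
  set G := (hs.hasStrictFDerivAt_equiv hder).toOpenPartialHomeomorph g with hG
  have hGx : φ x ∈ G.source :=
    (hs.hasStrictFDerivAt_equiv hder).mem_toOpenPartialHomeomorph_source
  have hGc : ∀ z, G z = g z := fun z => rfl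
  refine ⟨((φ.trans G).trans ψ.symm).restrOpen (φ.source ∩ β ⁻¹' ψ.source)
    (φ.open_source.inter (ψ.open_source.preimage hβc)), ?_, ?_⟩
  · have hmx : x ∈ φ.source := mem_chart_source ℂ x
    have hm : β x ∈ ψ.source := mem_chart_source ℂ (β x)
    simp [hGx, hGc, hg, hmx, hm, φ.left_inv hmx, ψ.map_source hm]
  · intro z hz
    have hz' : z ∈ φ.source ∧ β z ∈ ψ.source := hz.2
    simp [hGc, hg, φ.left_inv hz'.1, ψ.left_inv hz'.2]

end Basic

section FiberProduct

variable {S₀ S₁ S₂ : Type*}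
  [TopologicalSpace S₀] [ChartedSpace ℂ S₀]
  [TopologicalSpace S₁] [ChartedSpace ℂ S₁]
  [TopologicalSpace S₂] [ChartedSpace ℂ S₂]

/-- The fibre product of the pairs `(S₁, β₁)` and `(S₂, β₂)`. -/
def fiberProduct (β₁ : HolomorphicMap S₁ S₀) (β₂ : HolomorphicMap S₂ S₀) : Set (S₁ × S₂) :=
  {z | β₁ z.1 = β₂ z.2}

/-- The points of `S₀` that are a branch value of `β₁` or of `β₂`. -/
def branchSet (β₁ : HolomorphicMap S₁ S₀) (β₂ : HolomorphicMap S₂ S₀) : Set S₀ :=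
  β₁.branchValues ∪ β₂.branchValues

/-- The part of the fibre product that lies over the complement of the branch set, with the
subspace topology of `S₁ × S₂`. -/
def FiberProductStar (β₁ : HolomorphicMap S₁ S₀) (β₂ : HolomorphicMap S₂ S₀) : Type _ :=
  {z : S₁ × S₂ // z ∈ fiberProduct β₁ β₂ ∧ β₁ z.1 ∉ branchSet β₁ β₂}

/-- The branch set is closed. -/
theorem isClosed_branchSet [ClosedRiemannSurface S₀] [ClosedRiemannSurface S₁]
    [ClosedRiemannSurface S₂] (β₁ : HolomorphicMap S₁ S₀) (β₂ : HolomorphicMap S₂ S₀) :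
    IsClosed (branchSet β₁ β₂) :=
  (β₁.isClosed_criticalPoints.isCompact.image β₁.holomorphic.continuous).isClosed.union
    (β₂.isClosed_criticalPoints.isCompact.image β₂.holomorphic.continuous).isClosed

namespace FiberProductStar

variable (β₁ : HolomorphicMap S₁ S₀) (β₂ : HolomorphicMap S₂ S₀)

instance : TopologicalSpace (FiberProductStar β₁ β₂) :=
  instTopologicalSpaceSubtype

instance [T2Space S₁] [T2Space S₂] : T2Space (FiberProductStar β₁ β₂) :=
  inferInstanceAs (T2Space {z : S₁ × S₂ // z ∈ fiberProduct β₁ β₂ ∧ β₁ z.1 ∉ branchSet β₁ β₂})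

variable {β₁ β₂}

/-- The projection to `S₁`. -/
def fst (z : FiberProductStar β₁ β₂) : S₁ := z.1.1

/-- The projection to `S₂`. -/
def snd (z : FiberProductStar β₁ β₂) : S₂ := z.1.2

theorem continuous_fst : Continuous (fst (β₁ := β₁) (β₂ := β₂)) :=
  _root_.continuous_fst.comp continuous_subtype_val

theorem continuous_snd : Continuous (snd (β₁ := β₁) (β₂ := β₂)) :=
  _root_.continuous_snd.comp continuous_subtype_val

theorem comm (z : FiberProductStar β₁ β₂) : β₁ z.fst = β₂ z.snd := z.2.1

theorem snd_not_critical (z : FiberProductStar β₁ β₂) : z.snd ∉ β₂.criticalPoints :=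
  fun h => z.2.2 (Or.inr ⟨z.snd, h, z.comm.symm⟩)

/-- The point of the fibre product with given coordinates. -/
def mk (a : S₁) (b : S₂) (h : β₁ a = β₂ b) (h' : β₁ a ∉ branchSet β₁ β₂) :
    FiberProductStar β₁ β₂ := ⟨(a, b), h, h'⟩

open Classical in
/-- The section `a ↦ (a, ψ⁻¹ (β₁ a))` of the projection to `S₁` given by a local inverse of `β₂`
(with the value `x` outside its domain). -/
noncomputable def localSection (x : FiberProductStar β₁ β₂) (ψ : OpenPartialHomeomorph S₂ S₀)
    (hψ : Set.EqOn β₂ ψ ψ.source) (a : S₁) : FiberProductStar β₁ β₂ :=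
  if h : β₁ a ∈ ψ.target ∧ β₁ a ∉ branchSet β₁ β₂ then
    mk a (ψ.symm (β₁ a)) ((hψ (ψ.map_target h.1)).trans (ψ.right_inv h.1)).symm h.2
  else x

theorem localSection_val (x : FiberProductStar β₁ β₂) (ψ : OpenPartialHomeomorph S₂ S₀)
    (hψ : Set.EqOn β₂ ψ ψ.source) {a : S₁} (h : β₁ a ∈ ψ.target ∧ β₁ a ∉ branchSet β₁ β₂) :
    (localSection x ψ hψ a).1 = (a, ψ.symm (β₁ a)) := by
  unfold localSection
  rw [dif_pos h]
  rfl

/-- The projection to `S₁` is a local homeomorphism. -/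
theorem exists_local_fst [ClosedRiemannSurface S₀] [ClosedRiemannSurface S₁]
    [ClosedRiemannSurface S₂] (x : FiberProductStar β₁ β₂) :
    ∃ e : OpenPartialHomeomorph (FiberProductStar β₁ β₂) S₁,
      x ∈ e.source ∧ ∀ z, e z = z.fst := by
  obtain ⟨ψ, hxψ, hψ⟩ := β₂.exists_localInverse (snd_not_critical x)
  have hc : Continuous β₁ := β₁.holomorphic.continuous
  have hval := fun {a} h => localSection_val (a := a) x ψ hψ h
  have hsrc : ∀ z : FiberProductStar β₁ β₂, z.snd ∈ ψ.source →
      β₁ z.fst ∈ ψ.target ∧ β₁ z.fst ∉ branchSet β₁ β₂ := by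
    intro z hz
    refine ⟨?_, z.2.2⟩
    rw [z.comm, hψ hz]
    exact ψ.map_source hz
  refine ⟨{ toFun := fst
            invFun := localSection x ψ hψ
            source := snd ⁻¹' ψ.source
            target := {a | β₁ a ∈ ψ.target ∧ β₁ a ∉ branchSet β₁ β₂}
            map_source' := hsrc
            map_target' := ?_
            left_inv' := ?_
            right_inv' := ?_
            open_source := ψ.open_source.preimage continuous_snd
            open_target := (ψ.open_target.preimage hc).inter
              ((isClosed_branchSet β₁ β₂).isOpen_compl.preimage hc)
            continuousOn_toFun := continuous_fst.continuousOn
            continuousOn_invFun := ?_ }, hxψ, fun z => rfl⟩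
  · intro a ha
    show (localSection x ψ hψ a).1.2 ∈ ψ.source
    rw [hval ha]
    exact ψ.map_target ha.1
  · intro z hz
    apply Subtype.ext
    rw [hval (hsrc z hz), z.comm, hψ hz, ψ.left_inv hz]
    rfl
  · intro a ha
    show (localSection x ψ hψ a).1.1 = a
    rw [hval ha]
  · have h : ContinuousOn (fun a => (a, ψ.symm (β₁ a)))
        {a | β₁ a ∈ ψ.target ∧ β₁ a ∉ branchSet β₁ β₂} :=
      continuousOn_id.prodMk (ψ.continuousOn_symm.comp hc.continuousOn (fun a ha => ha.1))
    exact Topology.IsInducing.subtypeVal.continuousOn_iff.2 (h.congr (fun a ha => hval ha))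

variable [ClosedRiemannSurface S₀] [ClosedRiemannSurface S₁] [ClosedRiemannSurface S₂]

/-- The projection to `S₁` as a homeomorphism from a neighbourhood of `x` to an open set. -/
noncomputable def localFst (x : FiberProductStar β₁ β₂) :
    OpenPartialHomeomorph (FiberProductStar β₁ β₂) S₁ :=
  (exists_local_fst x).choose

theorem mem_localFst_source (x : FiberProductStar β₁ β₂) : x ∈ (localFst x).source :=
  (exists_local_fst x).choose_spec.1

theorem localFst_apply (x z : FiberProductStar β₁ β₂) : localFst x z = z.fst :=
  (exists_local_fst x).choose_spec.2 z

/-- The complex structure: the local coordinates are the local coordinates of `S₁`, composed with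
the projection to `S₁` (which is a local homeomorphism). It is the structure of a complex
submanifold of `S₁ × S₂`, and both projections are holomorphic. -/
noncomputable instance : ChartedSpace ℂ (FiberProductStar β₁ β₂) where
  atlas := {e | ∃ x : FiberProductStar β₁ β₂, e = (localFst x).trans (chartAt ℂ x.fst)}
  chartAt x := (localFst x).trans (chartAt ℂ x.fst)
  mem_chart_source x := by
    simp [mem_localFst_source, localFst_apply]
  chart_mem_atlas x := ⟨x, rfl⟩

instance : IsManifold 𝓘(ℂ, ℂ) 1 (FiberProductStar β₁ β₂) where
  compatible := by
    rintro e e' ⟨x, rfl⟩ ⟨y, rfl⟩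
    have hc : (chartAt ℂ x.fst).symm.trans (chartAt ℂ y.fst) ∈ contDiffGroupoid 1 𝓘(ℂ, ℂ) :=
      HasGroupoid.compatible (chart_mem_atlas ℂ x.fst) (chart_mem_atlas ℂ y.fst)
    set E := ((localFst x).trans (chartAt ℂ x.fst)).symm.trans
      ((localFst y).trans (chartAt ℂ y.fst)) with hE
    have hfst : ∀ a ∈ (localFst x).target, ((localFst x).symm a).fst = a := by
      intro a ha
      rw [← localFst_apply x, (localFst x).right_inv ha]
    have hsub : ∀ z ∈ E.source, z ∈ ((chartAt ℂ x.fst).symm.trans (chartAt ℂ y.fst)).source ∧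
        E z = ((chartAt ℂ x.fst).symm.trans (chartAt ℂ y.fst)) z := by
      intro z hz
      simp only [hE, OpenPartialHomeomorph.trans_source, OpenPartialHomeomorph.symm_source,
        OpenPartialHomeomorph.trans_symm_eq_symm_trans_symm, Set.mem_inter_iff, Set.mem_preimage,
        OpenPartialHomeomorph.coe_trans, Function.comp_apply, localFst_apply] at hz
      obtain ⟨⟨h1, h2⟩, h3, h4⟩ := hz
      rw [hfst _ h2] at h4
      refine ⟨by simpa using ⟨h1, h4⟩, ?_⟩
      simp only [hE, OpenPartialHomeomorph.trans_symm_eq_symm_trans_symm,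
        OpenPartialHomeomorph.coe_trans, Function.comp_apply, localFst_apply, hfst _ h2]
    refine (contDiffGroupoid 1 𝓘(ℂ, ℂ)).mem_of_eqOnSource
      (closedUnderRestriction' hc E.open_source) ⟨?_, ?_⟩
    · ext z
      simp only [OpenPartialHomeomorph.restr_source, E.open_source.interior_eq, Set.mem_inter_iff]
      exact ⟨fun h => ⟨(hsub z h).1, h⟩, fun h => h.2⟩
    · intro z hz
      exact (hsub z hz).2

instance : LocallyConnectedSpace (FiberProductStar β₁ β₂) :=
  ChartedSpace.locallyConnectedSpace ℂ _

/-- The connected component of `x`, an open subset. These components are the surfaces `T_k`. -/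
def component (x : FiberProductStar β₁ β₂) : TopologicalSpace.Opens (FiberProductStar β₁ β₂) :=
  ⟨connectedComponent x, isOpen_connectedComponent⟩

/-- Each component is a Riemann surface. -/
instance (x : FiberProductStar β₁ β₂) : RiemannSurface (component x) where
  toConnectedSpace := isConnected_iff_connectedSpace.1 isConnected_connectedComponent

end FiberProductStar

/-- `R` is (biholomorphic to) an irreducible component of the fibre product: it is obtained from
one of the components `T_k` by adding the finitely many punctures. -/
def IsIrreducibleComponent [ClosedRiemannSurface S₀] [ClosedRiemannSurface S₁]
    [ClosedRiemannSurface S₂] (β₁ : HolomorphicMap S₁ S₀) (β₂ : HolomorphicMap S₂ S₀)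
    (R : Type*) [TopologicalSpace R] [ChartedSpace ℂ R] : Prop :=
  ClosedRiemannSurface R ∧
    ∃ x : FiberProductStar β₁ β₂, IsPunctureCompactification (FiberProductStar.component x) R

end FiberProduct

/-! Isomorphism of components. Suppose deck maps of `β₁` act transitively on the fibres over the
unbranched part of `S₀`. Every component `T` projects onto the whole unbranched part of `S₂`: the
closure of `T` in the compact `S₁ × S₂` adds only points over the branch set, so the image of `T` is
closed as well as open in a connected set (`exists_mem_connectedComponent`). Given components of `x`
and `y`, the first therefore contains a point `z` with the second coordinate of `y`. The first
coordinates of `z` and `y` lie in one fibre of `β₁`, and a deck map `f` carrying one to the other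
gives a self-homeomorphism `f × id` that sends `z` to `y`. It lies over `S₀`, to which the
projection is a local biholomorphism, so it is holomorphic and maps one component onto the other
(`biholomorphic_component`). Both forms of the hypothesis enter only through
`HasTransitiveDeckMaps`; in the group form, normality lets every element of the big group descend to
the quotient by the small one.

Existence of completions. At a point over the branch set, `β₁` and `β₂` become power maps with
exponents `m * d` and `n * d`, `m` and `n` coprime. The curve `z ^ (m * d) = w ^ (n * d)` minus the
origin splits according to the `d` possible values of `w ^ n / z ^ m`, and each piece is a punctured
disc `t ↦ (t ^ n, ζ * t ^ m)`. By compactness of the fibre product these discs are all the ends.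
Filling them in gives a compact surface, whose components compactify the `T_k`; regularity plays no
role here.

Uniqueness of completions. An isomorphism of components extends over the punctures, continuously
because small punctured neighbourhoods are connected, then holomorphically by removable
singularities (`biholomorphic_of_openEmbeddings`). So isomorphic components have isomorphic
completions. -/

/-! ### Local normal form of holomorphic maps -/

/-- A non-constant analytic germ is a power of a local biholomorphism. -/
theorem AnalyticAt.exists_pow_chart {g : ℂ → ℂ} {z₀ : ℂ} (hg : AnalyticAt ℂ g z₀)
    (hne : ¬ ∀ᶠ z in 𝓝 z₀, g z = g z₀) :
    ∃ m : ℕ, m ≠ 0 ∧ ∃ h : OpenPartialHomeomorph ℂ ℂ, z₀ ∈ h.source ∧ h z₀ = 0 ∧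
      DifferentiableOn ℂ h h.source ∧ DifferentiableOn ℂ h.symm h.target ∧
      ∀ z ∈ h.source, g z = g z₀ + h z ^ m := by
  have hf : AnalyticAt ℂ (fun z => g z - g z₀) z₀ := hg.sub analyticAt_const
  obtain ⟨n, k, hk, hk0, hfk⟩ := hf.exists_eventuallyEq_pow_smul_nonzero_iff.mpr
    (fun h => hne (h.mono fun z hz => sub_eq_zero.1 hz))
  have hn : n ≠ 0 := by
    rintro rfl
    have := hfk.self_of_nhds
    simp at this
    exact hk0 this.symm
  obtain ⟨c, hc⟩ := IsAlgClosed.exists_pow_nat_eq (k z₀) (Nat.pos_of_ne_zero hn)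
  have hc0 : c ≠ 0 := by
    rintro rfl
    rw [zero_pow hn] at hc
    exact hk0 hc.symm
  -- A holomorphic `n`-th root of `k` near `z₀`. Dividing by `k z₀` moves the argument of the
  -- logarithm close to `1`, away from the cut; `c` restores the value at `z₀`.
  set r : ℂ → ℂ := fun z => c * Complex.exp (Complex.log (k z / k z₀) / n) with hr
  have hra : AnalyticAt ℂ r z₀ := by
    refine analyticAt_const.mul (AnalyticAt.cexp ?_)
    refine AnalyticAt.div (AnalyticAt.clog (hk.div analyticAt_const hk0) ?_) analyticAt_const
      (by exact_mod_cast hn)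
    rw [div_self hk0]
    exact Complex.one_mem_slitPlane
  have hr0 : r z₀ ≠ 0 := mul_ne_zero hc0 (Complex.exp_ne_zero _)
  have hrn : ∀ᶠ z in 𝓝 z₀, r z ^ n = k z := by
    filter_upwards [hk.continuousAt.eventually_ne hk0] with z hz
    have hnC : (n : ℂ) ≠ 0 := by exact_mod_cast hn
    rw [hr]
    simp only
    rw [mul_pow, ← Complex.exp_nat_mul, mul_div_cancel₀ _ hnC,
      Complex.exp_log (div_ne_zero hz hk0), hc]
    field_simp
  -- Since `g - g z₀ = (z - z₀) ^ n * k`, this is an `n`-th root of `g - g z₀`, with derivative `r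
  -- z₀ ≠ 0` at `z₀`.
  set H : ℂ → ℂ := fun z => (z - z₀) * r z with hH
  have hHa : AnalyticAt ℂ H z₀ := (analyticAt_id.sub analyticAt_const).mul hra
  have hHd : deriv H z₀ ≠ 0 := by
    have : HasDerivAt H (1 * r z₀ + (z₀ - z₀) * deriv r z₀) z₀ :=
      ((hasDerivAt_id z₀).sub_const z₀).mul hra.differentiableAt.hasDerivAt
    rw [this.deriv]
    simpa using hr0
  have hs : HasStrictDerivAt H (deriv H z₀) z₀ := hHa.hasStrictDerivAt
  set G := (hs.hasStrictFDerivAt_equiv hHd).toOpenPartialHomeomorph H with hG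
  have hGx : z₀ ∈ G.source := (hs.hasStrictFDerivAt_equiv hHd).mem_toOpenPartialHomeomorph_source
  have hGc : ∀ z, G z = H z := fun z => rfl
  have hev : ∀ᶠ z in 𝓝 z₀, g z = g z₀ + H z ^ n ∧ AnalyticAt ℂ H z ∧ deriv H z ≠ 0 := by
    filter_upwards [hfk, hrn, hHa.eventually_analyticAt,
      hHa.deriv.continuousAt.eventually_ne hHd] with z h1 h2 h3 h4
    refine ⟨?_, h3, h4⟩
    rw [hH]
    simp only
    rw [mul_pow, h2, ← smul_eq_mul, ← h1]
    ring
  obtain ⟨O, hO, hOo, hz₀O⟩ := eventually_nhds_iff.1 hev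
  refine ⟨n, hn, G.restrOpen O hOo, ⟨hGx, hz₀O⟩, ?_, ?_, ?_, ?_⟩
  · simp [hGc, hH]
  · intro z hz
    exact (hO z hz.2).2.1.differentiableAt.differentiableWithinAt
  · intro t ht
    have hmem := (G.restrOpen O hOo).map_target ht
    have := (G.restrOpen O hOo).hasDerivAt_symm ht (hO _ hmem.2).2.2
      ((hO _ hmem.2).2.1.differentiableAt.hasDerivAt)
    exact this.differentiableAt.differentiableWithinAt
  · intro z hz
    exact (hO z hz.2).1

section Local

variable {X Y Z : Type*} [TopologicalSpace X] [ChartedSpace ℂ X] [TopologicalSpace Y]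
  [ChartedSpace ℂ Y] [TopologicalSpace Z] [ChartedSpace ℂ Z]

theorem OpenPartialHomeomorph.MDifferentiable.restrOpen {e : OpenPartialHomeomorph X Y}
    (he : e.MDifferentiable 𝓘(ℂ, ℂ) 𝓘(ℂ, ℂ)) (s : Set X) (hs : IsOpen s) :
    (e.restrOpen s hs).MDifferentiable 𝓘(ℂ, ℂ) 𝓘(ℂ, ℂ) :=
  ⟨he.1.mono Set.inter_subset_left, he.2.mono Set.inter_subset_left⟩

variable [IsManifold 𝓘(ℂ, ℂ) 1 X] [IsManifold 𝓘(ℂ, ℂ) 1 Y]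

/-- The coordinate expression of a holomorphic map is analytic. -/
theorem MDifferentiable.analyticAt_chart {f : X → Y} (hf : MDifferentiable 𝓘(ℂ, ℂ) 𝓘(ℂ, ℂ) f)
    (x : X) :
    AnalyticAt ℂ (chartAt ℂ (f x) ∘ f ∘ (chartAt ℂ x).symm) (chartAt ℂ x x) := by
  set φ := chartAt ℂ x with hφ
  set ψ := chartAt ℂ (f x) with hψ
  set V : Set ℂ := φ.target ∩ φ.symm ⁻¹' (f ⁻¹' ψ.source) with hV
  have hVo : IsOpen V := φ.isOpen_inter_preimage_symm (ψ.open_source.preimage hf.continuous)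
  have hxV : φ x ∈ V := by
    refine ⟨mem_chart_target ℂ x, ?_⟩
    simp [hφ, hψ]
  have hgd : DifferentiableOn ℂ (ψ ∘ f ∘ φ.symm) V := by
    rw [← mdifferentiableOn_iff_differentiableOn]
    have h3 : MDifferentiableOn 𝓘(ℂ, ℂ) 𝓘(ℂ, ℂ) (f ∘ φ.symm) V :=
      hf.comp_mdifferentiableOn
        ((mdifferentiableOn_atlas_symm (chart_mem_atlas ℂ x)).mono Set.inter_subset_left)
    exact (mdifferentiableOn_atlas (chart_mem_atlas ℂ (f x))).comp h3 (fun z hz => hz.2)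
  exact hgd.analyticAt (hVo.mem_nhds hxV)

omit [IsManifold 𝓘(ℂ, ℂ) 1 X] in
theorem eventually_chart_symm_iff (x : X) {p : X → Prop} :
    (∀ᶠ t in 𝓝 (chartAt ℂ x x), p ((chartAt ℂ x).symm t)) ↔ ∀ᶠ z in 𝓝 x, p z := by
  rw [← (chartAt ℂ x).symm_map_nhds_eq (mem_chart_source ℂ x), Filter.eventually_map]

/-- Local normal form: a holomorphic map that is not locally constant at `x` is a power map in
suitable holomorphic coordinates. -/
theorem MDifferentiable.exists_pow_chart {f : X → Y} (hf : MDifferentiable 𝓘(ℂ, ℂ) 𝓘(ℂ, ℂ) f)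
    {x : X} (hne : ¬ ∀ᶠ z in 𝓝 x, f z = f x) :
    ∃ m : ℕ, m ≠ 0 ∧ ∃ φ : OpenPartialHomeomorph X ℂ, x ∈ φ.source ∧ φ x = 0 ∧
      φ.MDifferentiable 𝓘(ℂ, ℂ) 𝓘(ℂ, ℂ) ∧
      ∀ z ∈ φ.source, f z ∈ (chartAt ℂ (f x)).source ∧
        chartAt ℂ (f x) (f z) = chartAt ℂ (f x) (f x) + φ z ^ m := by
  set κ := chartAt ℂ x with hκ
  set ψ := chartAt ℂ (f x) with hψ
  have hxκ : x ∈ κ.source := mem_chart_source ℂ x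
  have hmem : ∀ᶠ z in 𝓝 x, f z ∈ ψ.source :=
    hf.continuous.continuousAt (ψ.open_source.mem_nhds (mem_chart_source ℂ (f x)))
  obtain ⟨m, hm, h, hx, h0, hd, hd', hpow⟩ := (hf.analyticAt_chart x).exists_pow_chart (by
    intro hc
    apply hne
    simp only [Function.comp_apply] at hc
    rw [(chartAt ℂ x).left_inv (mem_chart_source ℂ x)] at hc
    have := (eventually_chart_symm_iff x (p := fun z => ψ (f z) = ψ (f x))).1 hc
    filter_upwards [this, hmem] with z hz hz'
    exact ψ.injOn hz' (mem_chart_source ℂ (f x)) hz)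
  refine ⟨m, hm, (κ.trans h).restrOpen (f ⁻¹' ψ.source) (ψ.open_source.preimage hf.continuous),
    ?_, ?_, ?_, ?_⟩
  · exact ⟨by simp [hx, hκ], mem_chart_source ℂ (f x)⟩
  · exact h0
  · refine OpenPartialHomeomorph.MDifferentiable.restrOpen ?_ _ _
    refine (mdifferentiable_chart (I := 𝓘(ℂ, ℂ)) x).trans (I' := 𝓘(ℂ, ℂ)) (I'' := 𝓘(ℂ, ℂ)) ?_
    exact ⟨mdifferentiableOn_iff_differentiableOn.2 hd, mdifferentiableOn_iff_differentiableOn.2 hd'⟩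
  · rintro z ⟨hz, hz'⟩
    refine ⟨hz', ?_⟩
    rw [OpenPartialHomeomorph.trans_source] at hz
    have := hpow (κ z) hz.2
    simp only [Function.comp_apply] at this
    rw [← hκ, κ.left_inv hz.1, κ.left_inv hxκ] at this
    exact this

end Local

/-! ### Critical points, punctured neighbourhoods, local biholomorphisms, identity theorem -/

section Consequences

variable {X Y Z : Type*} [TopologicalSpace X] [ChartedSpace ℂ X] [TopologicalSpace Y]
  [ChartedSpace ℂ Y] [TopologicalSpace Z] [ChartedSpace ℂ Z]

/-- The critical points of a power map in holomorphic coordinates. -/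
theorem mfderiv_eq_zero_iff_of_pow_chart [IsManifold 𝓘(ℂ, ℂ) 1 X] [IsManifold 𝓘(ℂ, ℂ) 1 Y]
    {f : X → Y} (hf : MDifferentiable 𝓘(ℂ, ℂ) 𝓘(ℂ, ℂ) f) {y : Y} {c : ℂ}
    {m : ℕ} (hm : m ≠ 0) {φ : OpenPartialHomeomorph X ℂ}
    (hφ : φ.MDifferentiable 𝓘(ℂ, ℂ) 𝓘(ℂ, ℂ))
    (h : ∀ z ∈ φ.source, f z ∈ (chartAt ℂ y).source ∧ chartAt ℂ y (f z) = c + φ z ^ m)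
    {z : X} (hz : z ∈ φ.source) :
    mfderiv 𝓘(ℂ, ℂ) 𝓘(ℂ, ℂ) f z = 0 ↔ φ z ^ (m - 1) = 0 := by
  set ψ := chartAt ℂ y with hψ
  have hψd : ψ.MDifferentiable 𝓘(ℂ, ℂ) 𝓘(ℂ, ℂ) := mdifferentiable_chart y
  have h1 := mfderiv_comp z (hψd.mdifferentiableAt (h z hz).1) (hf z)
  have hP : HasDerivAt (fun t : ℂ => c + t ^ m) (m * φ z ^ (m - 1)) (φ z) := by
    simpa using (hasDerivAt_pow m (φ z)).const_add c
  have h2 := mfderiv_comp z (I := 𝓘(ℂ, ℂ)) (I' := 𝓘(ℂ, ℂ)) (I'' := 𝓘(ℂ, ℂ))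
    (g := fun t : ℂ => c + t ^ m) hP.differentiableAt.mdifferentiableAt (hφ.mdifferentiableAt hz)
  have heq : (ψ ∘ f) =ᶠ[𝓝 z] ((fun t : ℂ => c + t ^ m) ∘ φ) := by
    filter_upwards [φ.open_source.mem_nhds hz] with w hw using (h w hw).2
  rw [heq.mfderiv_eq, h2, mfderiv_eq_fderiv] at h1
  set A : ℂ →L[ℂ] ℂ := mfderiv 𝓘(ℂ, ℂ) 𝓘(ℂ, ℂ) ψ (f z) with hA
  set B : ℂ →L[ℂ] ℂ := mfderiv 𝓘(ℂ, ℂ) 𝓘(ℂ, ℂ) f z with hB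
  set C : ℂ →L[ℂ] ℂ := mfderiv 𝓘(ℂ, ℂ) 𝓘(ℂ, ℂ) φ z with hC
  -- The chain rule for the two expressions `ψ ∘ f` and `c + φ ^ m` of one map. As `A` is injective
  -- and `C` is surjective, `B` vanishes exactly when the scalar on the left does.
  have key : ∀ v : ℂ, (φ z ^ (m - 1) * m) * C v = A (B v) := by
    intro v
    have h3 : fderiv ℂ (fun t : ℂ => c + t ^ m) (φ z) (C v) = A (B v) := DFunLike.congr_fun h1 v
    rw [← h3, hP.hasFDerivAt.fderiv]
    simp [mul_comm]
  have hmC : (m : ℂ) ≠ 0 := by exact_mod_cast hm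
  show B = 0 ↔ _
  constructor
  · intro h0
    obtain ⟨v, hv⟩ : ∃ v : ℂ, C v = 1 := hφ.mfderiv_surjective hz (1 : ℂ)
    have h4 := key v
    rw [hv, h0, mul_one, zero_apply, map_zero] at h4
    exact (mul_eq_zero.1 h4).resolve_right hmC
  · intro h0
    have hAinj : Function.Injective A := hψd.mfderiv_injective (h z hz).1
    refine ContinuousLinearMap.ext fun v => hAinj ?_
    rw [← key v, h0, zero_mul, zero_mul]
    simp

/-- A chart would carry an isolated point to an isolated point of `ℂ`. -/
theorem nhdsNE_neBot_of_chartedSpace (x : X) : (𝓝[≠] x).NeBot := by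
  rw [← mem_closure_iff_nhdsWithin_neBot, mem_closure_iff_frequently]
  intro h
  have h' : ∀ᶠ t in 𝓝 (chartAt ℂ x x), (chartAt ℂ x).symm t = x := by
    have := (eventually_chart_symm_iff x (p := fun z => z = x)).2
      (h.mono fun z hz => not_not.1 hz)
    exact this
  have h2 : ∀ᶠ t in 𝓝 (chartAt ℂ x x), t = chartAt ℂ x x := by
    filter_upwards [h', (chartAt ℂ x).open_target.mem_nhds (mem_chart_target ℂ x)] with t ht ht'
    rw [← (chartAt ℂ x).right_inv ht', ht]
  have h3 : (𝓝[≠] (chartAt ℂ x x)) = ⊥ := by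
    rw [← Filter.empty_mem_iff_bot]
    have : {t | t = chartAt ℂ x x} ∈ 𝓝[≠] (chartAt ℂ x x) := mem_nhdsWithin_of_mem_nhds h2
    filter_upwards [this, self_mem_nhdsWithin] with t ht ht' using ht' ht
  exact (NormedField.nhdsNE_neBot (chartAt ℂ x x)).ne h3

/-- Polar coordinates present the set as a continuous image of a product of intervals. -/
theorem isPreconnected_punctured_ball (c : ℂ) (r : ℝ) :
    IsPreconnected (Metric.ball c r \ {c}) := by
  have : Metric.ball c r \ {c} =
      (fun p : ℝ × ℝ => c + p.1 * Complex.exp (p.2 * Complex.I)) '' (Set.Ioo 0 r ×ˢ Set.univ) := by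
    ext z
    constructor
    · rintro ⟨hz, hzc⟩
      refine ⟨(‖z - c‖, Complex.arg (z - c)), ⟨⟨norm_pos_iff.2 (sub_ne_zero.2 hzc), ?_⟩, trivial⟩, ?_⟩
      · simpa [dist_eq_norm] using hz
      · simp only
        rw [Complex.norm_mul_exp_arg_mul_I]
        ring
    · rintro ⟨⟨a, θ⟩, ⟨⟨ha, har⟩, -⟩, rfl⟩
      simp only at ha har ⊢
      refine ⟨?_, ?_⟩
      · simp [Complex.norm_exp_ofReal_mul_I, abs_of_pos ha, har]
      · simp [ha.ne']
  rw [this]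
  refine IsPreconnected.image ?_ _ (by fun_prop)
  exact isPreconnected_Ioo.prod isPreconnected_univ

/-- Punctured neighbourhoods in a one-dimensional complex manifold contain connected ones. -/
theorem exists_isPreconnected_nhdsNE {x : X} {s : Set X} (hs : s ∈ 𝓝[≠] x) :
    ∃ t ⊆ s, t ∈ 𝓝[≠] x ∧ IsPreconnected t := by
  set κ := chartAt ℂ x with hκ
  have hx := mem_chart_source ℂ x
  have h1 : ∀ᶠ z in 𝓝 x, z ≠ x → z ∈ s := eventually_nhdsWithin_iff.1 hs
  have h2 : ∀ᶠ t in 𝓝 (κ x), t ∈ κ.target ∧ (κ.symm t ≠ x → κ.symm t ∈ s) :=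
    Filter.Eventually.and (κ.open_target.mem_nhds (mem_chart_target ℂ x))
      ((eventually_chart_symm_iff x (p := fun z => z ≠ x → z ∈ s)).2 h1)
  obtain ⟨r, hr, hrs⟩ := Metric.eventually_nhds_iff_ball.1 h2
  refine ⟨κ.symm '' (Metric.ball (κ x) r \ {κ x}), ?_, ?_, ?_⟩
  · rintro _ ⟨t, ⟨ht, ht'⟩, rfl⟩
    refine (hrs t ht).2 fun h => ht' ?_
    rw [Set.mem_singleton_iff, ← κ.right_inv (hrs t ht).1, h]
  · have h3 : ∀ᶠ z in 𝓝 x, κ z ∈ Metric.ball (κ x) r :=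
      κ.continuousAt hx (Metric.ball_mem_nhds _ hr)
    filter_upwards [mem_nhdsWithin_of_mem_nhds h3,
      mem_nhdsWithin_of_mem_nhds (κ.open_source.mem_nhds hx), self_mem_nhdsWithin] with z hz hzs hzx
    exact ⟨κ z, ⟨hz, fun h => hzx (κ.injOn hzs hx h)⟩, κ.left_inv hzs⟩
  · exact (isPreconnected_punctured_ball _ _).image _
      (κ.continuousOn_symm.mono fun t ht => (hrs t ht.1).1)

/-- A small connected punctured neighbourhood cannot meet both sets. This is what makes removing a
point harmless for connectedness, and what forces limits at punctures to be unique. -/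
theorem mem_nhdsNE_or_of_disjoint {x : X} {U V : Set X} (hU : IsOpen U) (hV : IsOpen V)
    (hUV : Disjoint U V) (h : U ∪ V ∈ 𝓝[≠] x) : U ∈ 𝓝[≠] x ∨ V ∈ 𝓝[≠] x := by
  obtain ⟨t, hts, ht, htc⟩ := exists_isPreconnected_nhdsNE h
  by_cases hne : (t ∩ U).Nonempty
  · exact Or.inl (Filter.mem_of_superset ht (htc.subset_left_of_subset_union hU hV hUV hts hne))
  · refine Or.inr (Filter.mem_of_superset ht fun z hz => (hts hz).resolve_left fun hzU => ?_)
    exact hne ⟨z, hz, hzU⟩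

/-- The complement of a finite subset of a connected one-dimensional complex manifold is
connected. -/
theorem isPreconnected_compl_of_finite [T1Space X] [PreconnectedSpace X] {P : Set X}
    (hP : P.Finite) : IsPreconnected Pᶜ := by
  have hPo : IsOpen Pᶜ := hP.isClosed.isOpen_compl
  have hPn : ∀ x, Pᶜ ∈ 𝓝[≠] x := by
    intro x
    have : (P \ {x})ᶜ ∈ 𝓝 x := (hP.subset Set.sdiff_subset).isClosed.isOpen_compl.mem_nhds (by simp)
    filter_upwards [mem_nhdsWithin_of_mem_nhds this, self_mem_nhdsWithin] with z hz hzx hzP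
    exact hz ⟨hzP, hzx⟩
  rw [isPreconnected_iff_subset_of_disjoint]
  intro U V hU hV hsub hdis
  set A := Pᶜ ∩ U with hA
  set B := Pᶜ ∩ V with hB
  have hAo : IsOpen A := hPo.inter hU
  have hBo : IsOpen B := hPo.inter hV
  have hAB : Disjoint A B := by
    rw [Set.disjoint_iff]
    rintro z ⟨⟨h1, h2⟩, h3, h4⟩
    rw [← hdis]
    exact ⟨h1, h2, h4⟩
  have hcov : ∀ x, A ∪ B ∈ 𝓝[≠] x := fun x =>
    Filter.mem_of_superset (hPn x) fun z hz => (hsub hz).imp (fun h => ⟨hz, h⟩) (fun h => ⟨hz, h⟩)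
  -- Each half of the splitting is enlarged by the points of which it fills a punctured
  -- neighbourhood. The enlarged sets are open, disjoint because no point is isolated, and cover
  -- `X`, so the connectedness of `X` applies.
  have hopen : ∀ C : Set X, IsOpen C → IsOpen {x | C ∈ 𝓝[≠] x} := by
    intro C hC
    rw [isOpen_iff_mem_nhds]
    intro x hx
    have := eventually_nhdsWithin_iff.1 hx
    filter_upwards [this.eventually_nhds, (eventually_nhdsWithin_iff.1 hx)] with z hz hz'
    by_cases hzx : z = x
    · rw [hzx]; exact hx
    · exact mem_nhdsWithin_of_mem_nhds (hC.mem_nhds (hz' hzx))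
  have hmem : ∀ C : Set X, IsOpen C → C ⊆ {x | C ∈ 𝓝[≠] x} := fun C hC x hx =>
    mem_nhdsWithin_of_mem_nhds (hC.mem_nhds hx)
  have hdj : Disjoint {x | A ∈ 𝓝[≠] x} {x | B ∈ 𝓝[≠] x} := by
    rw [Set.disjoint_iff]
    rintro x ⟨h1, h2⟩
    have := (nhdsNE_neBot_of_chartedSpace x).ne
    apply this
    rw [← Filter.empty_mem_iff_bot, ← hAB.inter_eq]
    exact Filter.inter_mem h1 h2
  have huniv : (Set.univ : Set X) ⊆ {x | A ∈ 𝓝[≠] x} ∪ {x | B ∈ 𝓝[≠] x} := fun x _ =>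
    mem_nhdsNE_or_of_disjoint hAo hBo hAB (hcov x)
  by_cases hne : (Set.univ ∩ {x | A ∈ 𝓝[≠] x}).Nonempty
  · left
    have hall := isPreconnected_univ.subset_left_of_subset_union (hopen A hAo) (hopen B hBo) hdj
      huniv hne
    intro z hz
    by_contra hzU
    have hzB : z ∈ B := ⟨hz, (hsub hz).resolve_left hzU⟩
    exact Set.disjoint_left.1 hdj (hall (Set.mem_univ z)) (hmem B hBo hzB)
  · right
    intro z hz
    refine (hsub hz).resolve_left fun hzU => hne ⟨z, trivial, hmem A hAo ⟨hz, hzU⟩⟩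

variable [IsManifold 𝓘(ℂ, ℂ) 1 X] [IsManifold 𝓘(ℂ, ℂ) 1 Y]

omit [IsManifold 𝓘(ℂ, ℂ) 1 X] in
-- With exponent one, the normal form writes `f` as `φ`, then a translation, then an inverse chart,
-- all of them holomorphically invertible.
theorem exists_localBiholomorphism_of_pow_chart_one {f : X → Y} {x : X}
    {φ : OpenPartialHomeomorph X ℂ} (hx : x ∈ φ.source)
    (hφ : φ.MDifferentiable 𝓘(ℂ, ℂ) 𝓘(ℂ, ℂ))
    {c : ℂ} {y : Y}
    (h : ∀ z ∈ φ.source, f z ∈ (chartAt ℂ y).source ∧ chartAt ℂ y (f z) = c + φ z) :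
    ∃ e : OpenPartialHomeomorph X Y, x ∈ e.source ∧ e.MDifferentiable 𝓘(ℂ, ℂ) 𝓘(ℂ, ℂ) ∧
      Set.EqOn f e e.source := by
  set ψ := chartAt ℂ y
  have hτ : (Homeomorph.addLeft c).toOpenPartialHomeomorph.MDifferentiable 𝓘(ℂ, ℂ) 𝓘(ℂ, ℂ) := by
    refine ⟨mdifferentiableOn_iff_differentiableOn.2 ?_,
      mdifferentiableOn_iff_differentiableOn.2 ?_⟩
    · exact ((differentiable_id.const_add c).differentiableOn)
    · exact ((differentiable_id.const_add (-c)).differentiableOn)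
  refine ⟨(φ.trans (Homeomorph.addLeft c).toOpenPartialHomeomorph).trans ψ.symm, ?_,
    (hφ.trans hτ).trans (mdifferentiable_chart y).symm, ?_⟩
  · have := ψ.map_source (h x hx).1
    rw [(h x hx).2] at this
    simp [hx, this]
  · intro z hz
    have hz' : z ∈ φ.source := by
      simp at hz
      exact hz.1
    have h2 := h z hz'
    show f z = ψ.symm (c + φ z)
    rw [← h2.2, ψ.left_inv h2.1]

/-- Inverse function theorem, with a holomorphic local inverse. -/
theorem MDifferentiable.exists_localBiholomorphism {f : X → Y}
    (hf : MDifferentiable 𝓘(ℂ, ℂ) 𝓘(ℂ, ℂ) f) {x : X}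
    (hx : mfderiv 𝓘(ℂ, ℂ) 𝓘(ℂ, ℂ) f x ≠ 0) :
    ∃ e : OpenPartialHomeomorph X Y, x ∈ e.source ∧ e.MDifferentiable 𝓘(ℂ, ℂ) 𝓘(ℂ, ℂ) ∧
      Set.EqOn f e e.source := by
  have hne : ¬ ∀ᶠ z in 𝓝 x, f z = f x := by
    intro h
    apply hx
    have h' : f =ᶠ[𝓝 x] fun _ => f x := h
    rw [h'.mfderiv_eq, mfderiv_const]
  obtain ⟨m, hm, φ, hxφ, h0, hφ, h⟩ := hf.exists_pow_chart hne
  have hm1 : m = 1 := by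
    by_contra hm1
    apply hx
    rw [mfderiv_eq_zero_iff_of_pow_chart hf hm hφ h hxφ, h0]
    exact zero_pow (by omega)
  subst hm1
  simp only [pow_one] at h
  exact exists_localBiholomorphism_of_pow_chart_one hxφ hφ h

/-- A holomorphic map that is injective near `x` is a local biholomorphism at `x`. -/
theorem MDifferentiable.exists_localBiholomorphism_of_injOn {f : X → Y}
    (hf : MDifferentiable 𝓘(ℂ, ℂ) 𝓘(ℂ, ℂ) f) {x : X} {U : Set X} (hU : U ∈ 𝓝 x)
    (hinj : Set.InjOn f U) :
    ∃ e : OpenPartialHomeomorph X Y, x ∈ e.source ∧ e.MDifferentiable 𝓘(ℂ, ℂ) 𝓘(ℂ, ℂ) ∧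
      Set.EqOn f e e.source := by
  have hne : ¬ ∀ᶠ z in 𝓝 x, f z = f x := by
    intro h
    have h1 : ∀ᶠ z in 𝓝[≠] x, False := by
      filter_upwards [mem_nhdsWithin_of_mem_nhds h, mem_nhdsWithin_of_mem_nhds hU,
        self_mem_nhdsWithin] with z hz hzU hzx
      exact hzx (hinj hzU (mem_of_mem_nhds hU) hz)
    have := nhdsNE_neBot_of_chartedSpace x
    exact this.ne (Filter.empty_mem_iff_bot.1 h1)
  obtain ⟨m, hm, φ, hxφ, h0, hφ, h⟩ := hf.exists_pow_chart hne
  have hm1 : m = 1 := by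
    by_contra hm1
    have h0t : (0 : ℂ) ∈ φ.target := h0 ▸ φ.map_source hxφ
    have hs0 : φ.symm 0 = x := by rw [← h0, φ.left_inv hxφ]
    have h1 : ∀ᶠ t in 𝓝 (0 : ℂ), t ∈ φ.target ∧ φ.symm t ∈ U := by
      refine Filter.Eventually.and (φ.open_target.mem_nhds h0t) ?_
      have := (φ.continuousAt_symm h0t).tendsto
      rw [hs0] at this
      exact this hU
    -- For exponent `m ≥ 2`, the points with coordinates `t` and `ζ * t` have the same image and are
    -- distinct for `t ≠ 0`, against injectivity.
    set ζ := Complex.exp (2 * Real.pi * Complex.I / m) with hζ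
    have hprim : IsPrimitiveRoot ζ m := Complex.isPrimitiveRoot_exp m hm
    have hζ1 : ζ ≠ 1 := hprim.ne_one (by omega)
    have h2 : ∀ᶠ t in 𝓝 (0 : ℂ), ζ * t ∈ φ.target ∧ φ.symm (ζ * t) ∈ U := by
      have : Filter.Tendsto (fun t : ℂ => ζ * t) (𝓝 0) (𝓝 0) := by
        have h3 : Continuous (fun t : ℂ => ζ * t) := by fun_prop
        simpa using h3.tendsto 0
      exact this.eventually h1
    have h3 : ∀ᶠ t in 𝓝[≠] (0 : ℂ), False := by
      filter_upwards [mem_nhdsWithin_of_mem_nhds h1, mem_nhdsWithin_of_mem_nhds h2,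
        self_mem_nhdsWithin] with t ht1 ht2 ht
      have e1 := h _ (φ.map_target ht1.1)
      have e2 := h _ (φ.map_target ht2.1)
      rw [φ.right_inv ht1.1] at e1
      rw [φ.right_inv ht2.1, mul_pow, hprim.pow_eq_one, one_mul] at e2
      have e3 := (chartAt ℂ (f x)).injOn e1.1 e2.1 (e1.2.trans e2.2.symm)
      have e4 := hinj ht1.2 ht2.2 e3
      have e5 := φ.symm.injOn ht1.1 ht2.1 e4
      apply hζ1
      have e6 : (ζ - 1) * t = 0 := by rw [sub_mul, one_mul, ← e5, sub_self]
      exact sub_eq_zero.1 ((mul_eq_zero.1 e6).resolve_right ht)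
    exact (NormedField.nhdsNE_neBot (0 : ℂ)).ne (Filter.empty_mem_iff_bot.1 h3)
  subst hm1
  simp only [pow_one] at h
  exact exists_localBiholomorphism_of_pow_chart_one hxφ hφ h

omit [IsManifold 𝓘(ℂ, ℂ) 1 X] [IsManifold 𝓘(ℂ, ℂ) 1 Y] in
/-- A continuous map whose composition with a local biholomorphism is holomorphic is holomorphic. -/
theorem mdifferentiableAt_of_localBiholomorphism_comp {f : X → Y} {p : Y → Z}
    {e : OpenPartialHomeomorph Y Z} {x : X} (he : e.MDifferentiable 𝓘(ℂ, ℂ) 𝓘(ℂ, ℂ))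
    (hx : f x ∈ e.source) (hpe : Set.EqOn p e e.source) (hf : ContinuousAt f x)
    (hpf : MDifferentiableAt 𝓘(ℂ, ℂ) 𝓘(ℂ, ℂ) (p ∘ f) x) :
    MDifferentiableAt 𝓘(ℂ, ℂ) 𝓘(ℂ, ℂ) f x := by
  have hmem : p (f x) ∈ e.target := by
    rw [hpe hx]
    exact e.map_source hx
  have h1 := (he.mdifferentiableAt_symm hmem).comp x hpf
  refine h1.congr_of_eventuallyEq ?_
  filter_upwards [hf (e.open_source.mem_nhds hx)] with z hz
  simp only [Function.comp_apply]
  rw [hpe hz, e.left_inv hz]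

/-- Removable singularities: a continuous map that is holomorphic on a punctured neighbourhood is
holomorphic. -/
theorem mdifferentiableAt_of_continuousAt_of_eventually_nhdsNE {f : X → Y} {x : X}
    (hc : ContinuousAt f x) (h : ∀ᶠ z in 𝓝[≠] x, MDifferentiableAt 𝓘(ℂ, ℂ) 𝓘(ℂ, ℂ) f z) :
    MDifferentiableAt 𝓘(ℂ, ℂ) 𝓘(ℂ, ℂ) f x := by
  set κ := chartAt ℂ x with hκ
  set ψ := chartAt ℂ (f x) with hψ
  have hxκ := mem_chart_source ℂ x
  have hκs : κ.symm (κ x) = x := κ.left_inv hxκ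
  have hmem : ∀ᶠ z in 𝓝 x, f z ∈ ψ.source :=
    hc (ψ.open_source.mem_nhds (mem_chart_source ℂ (f x)))
  set g := ψ ∘ f ∘ κ.symm with hg
  have hgc : ContinuousAt g (κ x) := by
    refine ContinuousAt.comp (g := ψ) ?_ (ContinuousAt.comp (g := f) ?_
      (κ.continuousAt_symm (mem_chart_target ℂ x)))
    · simp only [Function.comp_apply, hκs]
      exact ψ.continuousAt (mem_chart_source ℂ (f x))
    · rw [hκs]
      exact hc
  have hgd : ∀ᶠ t in 𝓝[≠] (κ x), DifferentiableAt ℂ g t := by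
    have h1 := (eventually_chart_symm_iff x
      (p := fun z => f z ∈ ψ.source ∧ (z ≠ x → MDifferentiableAt 𝓘(ℂ, ℂ) 𝓘(ℂ, ℂ) f z))).2
      (hmem.and (eventually_nhdsWithin_iff.1 h))
    filter_upwards [mem_nhdsWithin_of_mem_nhds h1,
      mem_nhdsWithin_of_mem_nhds (κ.open_target.mem_nhds (mem_chart_target ℂ x)),
      self_mem_nhdsWithin] with t ht htt htx
    have hne : κ.symm t ≠ x := by
      intro h2
      apply htx
      rw [Set.mem_singleton_iff, ← κ.right_inv htt, h2]
    rw [← mdifferentiableAt_iff_differentiableAt]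
    exact ((mdifferentiable_chart (I := 𝓘(ℂ, ℂ)) (f x)).mdifferentiableAt ht.1).comp t
      ((ht.2 hne).comp t
        ((mdifferentiable_chart (I := 𝓘(ℂ, ℂ)) x).mdifferentiableAt_symm htt))
  have hga := (Complex.analyticAt_of_differentiable_on_punctured_nhds_of_continuousAt hgd hgc)
  have hgκ : MDifferentiableAt 𝓘(ℂ, ℂ) 𝓘(ℂ, ℂ) (g ∘ κ) x :=
    hga.differentiableAt.mdifferentiableAt.comp x
      ((mdifferentiable_chart (I := 𝓘(ℂ, ℂ)) x).mdifferentiableAt hxκ)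
  refine mdifferentiableAt_of_localBiholomorphism_comp (p := ψ) (e := ψ) (Z := ℂ)
    (mdifferentiable_chart (f x)) (mem_chart_source ℂ (f x)) (Set.eqOn_refl _ _) hc ?_
  refine hgκ.congr_of_eventuallyEq ?_
  filter_upwards [κ.open_source.mem_nhds hxκ] with z hz
  simp [hg, κ.left_inv hz]

/-- In the coordinate `φ` the map is a constant plus `φ ^ m`, so near `x` its value at `x` and a
zero of its derivative can recur only where `φ = 0`, that is at `x`. Fibres and critical points are
thus discrete. -/
theorem MDifferentiable.eventually_nhdsNE {f : X → Y} (hf : MDifferentiable 𝓘(ℂ, ℂ) 𝓘(ℂ, ℂ) f)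
    {x : X} (hne : ¬ ∀ᶠ z in 𝓝 x, f z = f x) (c : Y) [T1Space Y] :
    ∀ᶠ z in 𝓝[≠] x, f z ≠ c ∧ mfderiv 𝓘(ℂ, ℂ) 𝓘(ℂ, ℂ) f z ≠ 0 := by
  obtain ⟨m, hm, φ, hxφ, h0, hφ, h⟩ := hf.exists_pow_chart hne
  have h1 : ∀ᶠ z in 𝓝[≠] x, φ z ≠ 0 ∧ z ∈ φ.source := by
    filter_upwards [mem_nhdsWithin_of_mem_nhds (φ.open_source.mem_nhds hxφ), self_mem_nhdsWithin]
      with z hz hzx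
    exact ⟨fun hz0 => hzx (φ.injOn hz hxφ (hz0.trans h0.symm)), hz⟩
  have h2 : ∀ᶠ z in 𝓝[≠] x, f z ≠ c := by
    by_cases hc : f x = c
    · filter_upwards [h1] with z hz hzc
      have h3 := (h z hz.2).2
      rw [hzc, hc] at h3
      exact pow_ne_zero m hz.1 (left_eq_add.1 h3)
    · exact mem_nhdsWithin_of_mem_nhds (hf.continuous.continuousAt.eventually_ne hc)
  filter_upwards [h1, h2] with z hz hz'
  refine ⟨hz', fun h3 => ?_⟩
  rw [mfderiv_eq_zero_iff_of_pow_chart hf hm hφ h hz.2] at h3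
  exact pow_ne_zero _ hz.1 h3

/-- Identity theorem: a non-constant holomorphic map on a connected surface is nowhere locally
constant. -/
theorem MDifferentiable.not_eventually_const [PreconnectedSpace X] [T1Space Y] {f : X → Y}
    (hf : MDifferentiable 𝓘(ℂ, ℂ) 𝓘(ℂ, ℂ) f) (hnc : ¬ ∃ c, ∀ x, f x = c) (x : X) :
    ¬ ∀ᶠ z in 𝓝 x, f z = f x := by
  intro hx
  set A : Set X := {a | ∀ᶠ z in 𝓝 a, f z = f x} with hA
  have hAo : IsOpen A := isOpen_iff_mem_nhds.2 fun a ha => ha.eventually_nhds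
  have hAc : IsClosed A := by
    rw [← isOpen_compl_iff, isOpen_iff_mem_nhds]
    intro a ha
    -- Either `f` is constant near `a`, then with a value other than `f x`, or it takes each value
    -- discretely there.
    have hstep : ∀ᶠ z in 𝓝[≠] a, f z ≠ f x := by
      by_cases hac : ∀ᶠ z in 𝓝 a, f z = f a
      · have hne : f a ≠ f x := fun h => ha (by simpa [hA, h] using hac)
        exact mem_nhdsWithin_of_mem_nhds (hf.continuous.continuousAt.eventually_ne hne)
      · exact (hf.eventually_nhdsNE hac (f x)).mono fun z hz => hz.1
    filter_upwards [eventually_nhdsWithin_iff.1 hstep] with z hz hzA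
    by_cases hza : z = a
    · exact ha (hza ▸ hzA)
    · exact hz hza hzA.self_of_nhds
  have huniv := IsClopen.eq_univ ⟨hAc, hAo⟩ ⟨x, hx⟩
  refine hnc ⟨f x, fun z => ?_⟩
  have hz : z ∈ A := huniv ▸ Set.mem_univ z
  exact hz.self_of_nhds

omit [ChartedSpace ℂ X] [IsManifold 𝓘(ℂ, ℂ) 1 X] in
-- An infinite subset of a compact space accumulates somewhere.
theorem Set.finite_of_eventually_nhdsNE_notMem [CompactSpace X] {s : Set X}
    (h : ∀ x, ∀ᶠ z in 𝓝[≠] x, z ∉ s) : s.Finite := by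
  by_contra hs
  obtain ⟨x, hx⟩ := Set.Infinite.exists_accPt_principal hs
  rw [accPt_iff_frequently_nhdsNE] at hx
  exact hx (h x)

end Consequences

/-! ### Finiteness of fibres, critical points and branch values -/

section Closed

variable {X Y : Type*} [TopologicalSpace X] [ChartedSpace ℂ X] [TopologicalSpace Y]
  [ChartedSpace ℂ Y] [ClosedRiemannSurface X] [ClosedRiemannSurface Y]

theorem HolomorphicMap.Nonconstant.finite_fiber {β : HolomorphicMap X Y} (hβ : β.Nonconstant)
    (y : Y) : (β ⁻¹' {y}).Finite :=
  Set.finite_of_eventually_nhdsNE_notMem fun x =>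
    (β.holomorphic.eventually_nhdsNE (β.holomorphic.not_eventually_const hβ x) y).mono
      fun _ hz => hz.1

theorem HolomorphicMap.Nonconstant.finite_criticalPoints {β : HolomorphicMap X Y}
    (hβ : β.Nonconstant) : β.criticalPoints.Finite :=
  Set.finite_of_eventually_nhdsNE_notMem fun x =>
    (β.holomorphic.eventually_nhdsNE (β.holomorphic.not_eventually_const hβ x) (β x)).mono
      fun _ hz => hz.2

theorem HolomorphicMap.Nonconstant.finite_preimage {β : HolomorphicMap X Y} (hβ : β.Nonconstant)
    {s : Set Y} (hs : s.Finite) : (β ⁻¹' s).Finite :=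
  hs.preimage' fun y _ => hβ.finite_fiber y

end Closed

theorem finite_branchSet {S₀ S₁ S₂ : Type*}
    [TopologicalSpace S₀] [ChartedSpace ℂ S₀] [ClosedRiemannSurface S₀]
    [TopologicalSpace S₁] [ChartedSpace ℂ S₁] [ClosedRiemannSurface S₁]
    [TopologicalSpace S₂] [ChartedSpace ℂ S₂] [ClosedRiemannSurface S₂]
    {β₁ : HolomorphicMap S₁ S₀} {β₂ : HolomorphicMap S₂ S₀}
    (hβ₁ : β₁.Nonconstant) (hβ₂ : β₂.Nonconstant) : (branchSet β₁ β₂).Finite :=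
  (hβ₁.finite_criticalPoints.image _).union (hβ₂.finite_criticalPoints.image _)

/-! ### Uniqueness of the compactification by finitely many points -/

section Uniqueness

variable {X R R' : Type*} [TopologicalSpace X] [ChartedSpace ℂ X] [TopologicalSpace R]
  [ChartedSpace ℂ R] [TopologicalSpace R'] [ChartedSpace ℂ R']

theorem Set.Finite.eventually_nhdsNE_notMem {Y : Type*} [TopologicalSpace Y] [T1Space Y] {P : Set Y}
    (hP : P.Finite) (x : Y) : ∀ᶠ z in 𝓝[≠] x, z ∉ P := by
  have : (P \ {x})ᶜ ∈ 𝓝 x := (hP.subset Set.sdiff_subset).isClosed.isOpen_compl.mem_nhds (by simp)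
  filter_upwards [mem_nhdsWithin_of_mem_nhds this, self_mem_nhdsWithin] with z hz hzx hzP
  exact hz ⟨hzP, hzx⟩

theorem Set.Finite.dense_compl_of_chartedSpace [T1Space R] {P : Set R} (hP : P.Finite) :
    Dense Pᶜ := by
  intro x
  have := nhdsNE_neBot_of_chartedSpace x
  rw [mem_closure_iff_frequently]
  exact ((hP.eventually_nhdsNE_notMem x).frequently).filter_mono nhdsWithin_le_nhds

omit [ChartedSpace ℂ X] [ChartedSpace ℂ R'] in
/-- A map into a compactification by finitely many points has limits at the punctures of
another one. -/
theorem exists_tendsto_comap_nhds [T2Space R] [T2Space R'] [CompactSpace R'] {ι : X → R}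
    {κ : X → R'} (hι : Topology.IsOpenEmbedding ι) (hκ : Topology.IsOpenEmbedding κ)
    (hιf : (Set.range ι)ᶜ.Finite) (hκf : (Set.range κ)ᶜ.Finite) (p : R) :
    ∃ q, Filter.Tendsto κ (Filter.comap ι (𝓝 p)) (𝓝 q) := by
  by_cases hp : p ∈ Set.range ι
  · obtain ⟨x, rfl⟩ := hp
    refine ⟨κ x, ?_⟩
    rw [← hι.isInducing.nhds_eq_comap]
    exact hκ.continuous.continuousAt
  have hd : Dense (Set.range ι) := by simpa using hιf.dense_compl_of_chartedSpace
  have hne : (Filter.comap ι (𝓝 p)).NeBot := by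
    rw [Filter.comap_neBot_iff]
    intro t ht
    obtain ⟨_, ⟨x, rfl⟩, hz⟩ := hd.inter_nhds_nonempty ht
    exact ⟨x, hz⟩
  obtain ⟨q, hq⟩ := exists_clusterPt_of_compactSpace (Filter.map κ (Filter.comap ι (𝓝 p)))
  refine ⟨q, ?_⟩
  rw [(nhds_basis_opens q).tendsto_right_iff]
  rintro N ⟨hqN, hN⟩
  -- `V` isolates the cluster point `q` from the other punctures, which lie in `W`. What is left of
  -- `R'` outside `(V ∩ N) ∪ W` is compact inside `κ(X)`, so its copy in `R` stays away from `p`.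
  -- Hence points near `p` are sent into `V ∩ N` or `W`, and by connectedness all into the same one.
  obtain ⟨V, W, hV, hW, hqV, hQW, hVW⟩ : SeparatedNhds {q} ((Set.range κ)ᶜ \ {q}) :=
    SeparatedNhds.of_isCompact_isCompact isCompact_singleton
      (hκf.subset Set.sdiff_subset).isCompact Set.disjoint_sdiff_right
  rw [Set.singleton_subset_iff] at hqV
  have hV'o : IsOpen (V ∩ N) := hV.inter hN
  have hKr : ((V ∩ N) ∪ W)ᶜ ⊆ Set.range κ := by
    intro z hz
    by_contra hzr
    by_cases hzq : z = q
    · exact hz (Or.inl (hzq ▸ ⟨hqV, hqN⟩))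
    · exact hz (Or.inr (hQW ⟨hzr, hzq⟩))
  have hKc : IsCompact (κ ⁻¹' ((V ∩ N) ∪ W)ᶜ) :=
    (hκ.isInducing.isCompact_preimage_iff hKr).2 (hV'o.union hW).isClosed_compl.isCompact
  have hpK : (ι '' (κ ⁻¹' ((V ∩ N) ∪ W)ᶜ))ᶜ ∈ 𝓝 p :=
    (hKc.image hι.continuous).isClosed.isOpen_compl.mem_nhds
      fun h => hp (Set.image_subset_range _ _ h)
  have hun : ι '' (κ ⁻¹' (V ∩ N)) ∪ ι '' (κ ⁻¹' W) ∈ 𝓝[≠] p := by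
    filter_upwards [mem_nhdsWithin_of_mem_nhds hpK, hιf.eventually_nhdsNE_notMem p] with z hz hzr
    obtain ⟨x, rfl⟩ := not_not.1 hzr
    rw [← Set.image_union]
    refine ⟨x, ?_, rfl⟩
    by_contra h
    exact hz ⟨x, h, rfl⟩
  have hcomap : ∀ s, ι '' s ∈ 𝓝[≠] p → s ∈ Filter.comap ι (𝓝 p) := by
    intro s hs
    refine Filter.mem_comap.2 ⟨_, mem_nhdsWithin_iff_eventually.1 hs, fun x hx => ?_⟩
    obtain ⟨y, hy, hyx⟩ := hx fun h => hp ⟨x, h⟩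
    exact hι.injective hyx ▸ hy
  rcases mem_nhdsNE_or_of_disjoint (hι.isOpenMap _ (hV'o.preimage hκ.continuous))
    (hι.isOpenMap _ (hW.preimage hκ.continuous))
    ((Set.disjoint_image_iff hι.injective).2
      ((hVW.mono_left Set.inter_subset_left).preimage κ)) hun with h | h
  · exact Filter.mem_of_superset (hcomap _ h) fun x hx => hx.2
  -- If the values near `p` lay in `W`, they would avoid the neighbourhood `V` of their cluster
  -- point `q`.
  · exfalso
    have h1 := hcomap _ h
    obtain ⟨z, hzV, hzW⟩ := (clusterPt_iff_nonempty.1 hq) (hV.mem_nhds hqV)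
      (Filter.image_mem_map h1)
    obtain ⟨x, hx, rfl⟩ := hzW
    exact Set.disjoint_left.1 hVW hzV hx

/-- A holomorphic map between punctured surfaces that is an open embedding with cofinite image
extends to the compactification. -/
theorem exists_holomorphic_extension [IsManifold 𝓘(ℂ, ℂ) 1 X] [IsManifold 𝓘(ℂ, ℂ) 1 R]
    [IsManifold 𝓘(ℂ, ℂ) 1 R'] [T2Space R] [T2Space R'] [CompactSpace R'] {ι : X → R}
    {κ : X → R'} (hι : Topology.IsOpenEmbedding ι) (hκ : Topology.IsOpenEmbedding κ)
    (hιd : MDifferentiable 𝓘(ℂ, ℂ) 𝓘(ℂ, ℂ) ι) (hκd : MDifferentiable 𝓘(ℂ, ℂ) 𝓘(ℂ, ℂ) κ)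
    (hιf : (Set.range ι)ᶜ.Finite) (hκf : (Set.range κ)ᶜ.Finite) :
    ∃ Φ : R → R', MDifferentiable 𝓘(ℂ, ℂ) 𝓘(ℂ, ℂ) Φ ∧ ∀ x, Φ (ι x) = κ x := by
  have hd : DenseRange ι := by simpa [DenseRange] using hιf.dense_compl_of_chartedSpace
  have hdi : IsDenseInducing ι := ⟨hι.isInducing, hd⟩
  have hc : Continuous (hdi.extend κ) :=
    hdi.continuous_extend fun p => exists_tendsto_comap_nhds hι hκ hιf hκf p
  have heq : ∀ x, hdi.extend κ (ι x) = κ x := fun x => hdi.extend_eq hκ.continuous x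
  refine ⟨hdi.extend κ, fun p => ?_, heq⟩
  refine mdifferentiableAt_of_continuousAt_of_eventually_nhdsNE hc.continuousAt ?_
  filter_upwards [hιf.eventually_nhdsNE_notMem p] with z hz
  obtain ⟨x, rfl⟩ := not_not.1 hz
  -- Away from the punctures the extension is `κ ∘ ι⁻¹`, and the injective `ι` has a holomorphic
  -- local inverse.
  obtain ⟨e, hxe, he, hee⟩ := hιd.exists_localBiholomorphism_of_injOn
    (Filter.univ_mem : Set.univ ∈ 𝓝 x) hι.injective.injOn
  have hxt : ι x ∈ e.target := hee hxe ▸ e.map_source hxe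
  have h1 : MDifferentiableAt 𝓘(ℂ, ℂ) 𝓘(ℂ, ℂ) (κ ∘ e.symm) (ι x) :=
    (hκd _).comp (ι x) (he.mdifferentiableAt_symm hxt)
  refine h1.congr_of_eventuallyEq ?_
  filter_upwards [e.open_target.mem_nhds hxt] with z hz
  conv_lhs => rw [← e.right_inv hz, ← hee (e.map_target hz), heq]
  rfl

/-- The compactification of a surface by finitely many points is unique. -/
theorem biholomorphic_of_openEmbeddings [IsManifold 𝓘(ℂ, ℂ) 1 X] [IsManifold 𝓘(ℂ, ℂ) 1 R]
    [IsManifold 𝓘(ℂ, ℂ) 1 R'] [T2Space R] [T2Space R'] [CompactSpace R] [CompactSpace R']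
    {ι : X → R} {κ : X → R'} (hι : Topology.IsOpenEmbedding ι) (hκ : Topology.IsOpenEmbedding κ)
    (hιd : MDifferentiable 𝓘(ℂ, ℂ) 𝓘(ℂ, ℂ) ι) (hκd : MDifferentiable 𝓘(ℂ, ℂ) 𝓘(ℂ, ℂ) κ)
    (hιf : (Set.range ι)ᶜ.Finite) (hκf : (Set.range κ)ᶜ.Finite) : Biholomorphic R R' := by
  obtain ⟨Φ, hΦ, hΦι⟩ := exists_holomorphic_extension hι hκ hιd hκd hιf hκf
  obtain ⟨Ψ, hΨ, hΨκ⟩ := exists_holomorphic_extension hκ hι hκd hιd hκf hιf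
  have hdι : DenseRange ι := by simpa [DenseRange] using hιf.dense_compl_of_chartedSpace
  have hdκ : DenseRange κ := by simpa [DenseRange] using hκf.dense_compl_of_chartedSpace
  have h1 : Ψ ∘ Φ = id := hdι.equalizer (hΨ.continuous.comp hΦ.continuous) continuous_id
    (by ext x; simp [hΦι, hΨκ])
  have h2 : Φ ∘ Ψ = id := hdκ.equalizer (hΦ.continuous.comp hΨ.continuous) continuous_id
    (by ext x; simp [hΦι, hΨκ])
  exact ⟨{ toFun := Φ, invFun := Ψ, left_inv := congrFun h1, right_inv := congrFun h2,
           continuous_toFun := hΦ.continuous, continuous_invFun := hΨ.continuous }, hΦ, hΨ⟩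

/-- Through the isomorphism both closed surfaces become compactifications of the same surface `X`.
-/
theorem IsPunctureCompactification.biholomorphic {Y : Type*} [TopologicalSpace Y]
    [ChartedSpace ℂ Y] [IsManifold 𝓘(ℂ, ℂ) 1 X] [ClosedRiemannSurface R] [ClosedRiemannSurface R']
    (hXR : IsPunctureCompactification X R) (hYR' : IsPunctureCompactification Y R')
    (hXY : Biholomorphic X Y) : Biholomorphic R R' := by
  obtain ⟨ι, hι, hιd, hιf⟩ := hXR
  obtain ⟨κ, hκ, hκd, hκf⟩ := hYR'
  obtain ⟨φ, hφ, -⟩ := hXY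
  refine biholomorphic_of_openEmbeddings hι (hκ.comp φ.isOpenEmbedding) hιd (hκd.comp hφ) hιf ?_
  rwa [φ.surjective.range_comp]

end Uniqueness

/-! ### Filling in the punctures of a surface -/

/-- A finite family of punctured discs in a surface `X` that describe all the ends of `X`: the
complement of arbitrarily small punctured discs is compact. -/
structure PuncturedEnds (X : Type*) [TopologicalSpace X] [ChartedSpace ℂ X] (J : Type*) where
  /-- The parametrization of an end by a punctured neighbourhood of `0`. -/
  param : J → OpenPartialHomeomorph ℂ X
  mdifferentiable : ∀ j, (param j).MDifferentiable 𝓘(ℂ, ℂ) 𝓘(ℂ, ℂ)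
  zero_notMem : ∀ j, 0 ∉ (param j).source
  source_mem : ∀ j, (param j).source ∈ 𝓝[≠] 0
  disjoint : ∀ i j, i ≠ j →
    Disjoint (Filter.map (param i) (𝓝[≠] 0)) (Filter.map (param j) (𝓝[≠] 0))
  cocompact : Filter.cocompact X = ⨆ j, Filter.map (param j) (𝓝[≠] 0)

namespace PuncturedEnds

variable {X J : Type*} [TopologicalSpace X] [ChartedSpace ℂ X] (E : PuncturedEnds X J)

/-- The surface with the punctures filled in. -/
def Completion (_ : PuncturedEnds X J) : Type _ := X ⊕ J

/-- The inclusion of the surface. -/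
def incl (x : X) : E.Completion := Sum.inl x

/-- The added points. -/
def pt (j : J) : E.Completion := Sum.inr j

theorem incl_injective : Function.Injective E.incl := Sum.inl_injective

theorem incl_ne_pt (x : X) (j : J) : E.incl x ≠ E.pt j := Sum.inl_ne_inr

theorem pt_injective : Function.Injective E.pt := Sum.inr_injective

theorem eq_incl_or_eq_pt (z : E.Completion) : (∃ x, z = E.incl x) ∨ ∃ j, z = E.pt j := by
  rcases z with x | j
  exacts [Or.inl ⟨x, rfl⟩, Or.inr ⟨j, rfl⟩]

/-- An open set containing an added point must contain a punctured disc of its end, so that `param j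
t` tends to `pt j` as `t → 0`. -/
instance : TopologicalSpace E.Completion where
  IsOpen U := IsOpen (E.incl ⁻¹' U) ∧
    ∀ j, E.pt j ∈ U → ∀ᶠ t in 𝓝[≠] (0 : ℂ), E.incl (E.param j t) ∈ U
  isOpen_univ := ⟨isOpen_univ, fun _ _ => Filter.Eventually.of_forall fun _ => trivial⟩
  isOpen_inter U V hU hV := ⟨hU.1.inter hV.1, fun j hj => (hU.2 j hj.1).and (hV.2 j hj.2)⟩
  isOpen_sUnion S hS := by
    refine ⟨?_, ?_⟩
    · rw [Set.preimage_sUnion]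
      exact isOpen_biUnion fun U hU => (hS U hU).1
    · rintro j ⟨U, hU, hj⟩
      exact ((hS U hU).2 j hj).mono fun t ht => ⟨U, hU, ht⟩

theorem isOpen_iff {U : Set E.Completion} : IsOpen U ↔ IsOpen (E.incl ⁻¹' U) ∧
    ∀ j, E.pt j ∈ U → ∀ᶠ t in 𝓝[≠] (0 : ℂ), E.incl (E.param j t) ∈ U := Iff.rfl

theorem isOpenEmbedding_incl : Topology.IsOpenEmbedding E.incl := by
  refine Topology.IsOpenEmbedding.of_continuous_injective_isOpenMap ?_ E.incl_injective ?_
  · exact continuous_def.2 fun U hU => hU.1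
  · intro U hU
    refine E.isOpen_iff.2 ⟨by rwa [Set.preimage_image_eq _ E.incl_injective], ?_⟩
    rintro j ⟨x, -, hx⟩
    exact (E.incl_ne_pt x j hx).elim

/-- The set `U` itself need not be open. The added point together with the image of a small open
punctured disc is an open set inside it, as `param j` is open on its source. -/
theorem mem_nhds_pt {j : J} {U : Set E.Completion} : U ∈ 𝓝 (E.pt j) ↔
    E.pt j ∈ U ∧ ∀ᶠ t in 𝓝[≠] (0 : ℂ), E.incl (E.param j t) ∈ U := by
  constructor
  · intro h
    obtain ⟨V, hVU, hV, hj⟩ := mem_nhds_iff.1 h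
    exact ⟨hVU hj, ((E.isOpen_iff.1 hV).2 j hj).mono fun t ht => hVU ht⟩
  · rintro ⟨hj, hU⟩
    obtain ⟨O, hO, hOo, h0O⟩ := eventually_nhds_iff.1
      (eventually_nhdsWithin_iff.1 (hU.and (E.source_mem j)))
    have hsub : O \ {0} ⊆ (E.param j).source := fun t ht => (hO t ht.1 ht.2).2
    refine mem_nhds_iff.2 ⟨insert (E.pt j) (E.incl '' (E.param j '' (O \ {0}))), ?_, ?_,
      Set.mem_insert _ _⟩
    · rintro _ (rfl | ⟨_, ⟨t, ht, rfl⟩, rfl⟩)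
      exacts [hj, (hO t ht.1 ht.2).1]
    · refine E.isOpen_iff.2 ⟨?_, ?_⟩
      · have : E.incl ⁻¹' insert (E.pt j) (E.incl '' (E.param j '' (O \ {0}))) =
            E.param j '' (O \ {0}) := by
          ext x
          constructor
          · rintro (h | ⟨y, hy, hyx⟩)
            · exact (E.incl_ne_pt x j h).elim
            · exact E.incl_injective hyx ▸ hy
          · exact fun h => Or.inr ⟨x, h, rfl⟩
        rw [this]
        exact (E.param j).isOpen_image_of_subset_source (hOo.sdiff isClosed_singleton) hsub
      · rintro k (h | ⟨y, -, hy⟩)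
        · obtain rfl := E.pt_injective h
          filter_upwards [mem_nhdsWithin_of_mem_nhds (hOo.mem_nhds h0O), self_mem_nhdsWithin]
            with t ht ht0
          exact Or.inr ⟨_, ⟨t, ⟨ht, ht0⟩, rfl⟩, rfl⟩
        · exact (E.incl_ne_pt y k hy).elim

theorem tendsto_incl_param (j : J) :
    Filter.Tendsto (fun t => E.incl (E.param j t)) (𝓝[≠] (0 : ℂ)) (𝓝 (E.pt j)) :=
  fun _ hU => (E.mem_nhds_pt.1 hU).2

theorem compl_range_incl : (Set.range E.incl)ᶜ = Set.range E.pt :=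
  Set.compl_range_inl

/-- An ultrafilter on the completion lives on the finite set of added points, or contains a compact
set of `X`, or escapes every compact set. In the last case it is finer than the supremum of the
ends; as these are finitely many, it follows a single end and converges to its added point. -/
instance [Finite J] : CompactSpace E.Completion := by
  refine ⟨isCompact_iff_ultrafilter_le_nhds.2 fun f _ => ?_⟩
  by_cases hf : Set.range E.incl ∈ f
  · set g := f.comap E.incl_injective hf with hg
    have hfg : (f : Filter E.Completion) = Filter.map E.incl g := by
      rw [hg, Ultrafilter.coe_comap, Filter.map_comap_of_mem hf]
    by_cases hgc : (g : Filter X) ≤ Filter.cocompact X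
    · rw [E.cocompact] at hgc
      obtain ⟨j, hj⟩ : ∃ j, (g : Filter X) ≤ Filter.map (E.param j) (𝓝[≠] 0) := by
        by_contra hcon
        push Not at hcon
        have h1 : ∀ j, ∃ s ∈ Filter.map (E.param j) (𝓝[≠] 0), s ∉ g := fun j => by
          simpa [Filter.not_le] using hcon j
        choose s hs hsg using h1
        have h2 : (⋃ j, s j) ∈ (g : Filter X) := hgc (by
          rw [Filter.mem_iSup]
          exact fun j => Filter.mem_of_superset (hs j) (Set.subset_iUnion s j))
        obtain ⟨j, hj⟩ := Ultrafilter.eventually_exists_iff.1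
          (show ∀ᶠ x in (g : Filter X), ∃ j, x ∈ s j from
            Filter.mem_of_superset h2 fun x hx => Set.mem_iUnion.1 hx)
        exact hsg j hj
      refine ⟨E.pt j, trivial, ?_⟩
      rw [hfg]
      exact (Filter.map_mono hj).trans (by
        rw [Filter.map_map]; exact E.tendsto_incl_param j)
    · obtain ⟨s, hs, hsg⟩ : ∃ s ∈ Filter.cocompact X, s ∉ g := by
        simpa [Filter.not_le] using hgc
      obtain ⟨K, hK, hKs⟩ := Filter.mem_cocompact.1 hs
      have hKg : K ∈ g := by
        by_contra h
        exact hsg (Filter.mem_of_superset (Ultrafilter.compl_mem_iff_notMem.2 h) hKs)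
      obtain ⟨x, -, hx⟩ := isCompact_iff_ultrafilter_le_nhds.1 hK g (Filter.le_principal_iff.2 hKg)
      refine ⟨E.incl x, trivial, ?_⟩
      rw [hfg]
      exact (Filter.map_mono hx).trans E.isOpenEmbedding_incl.continuous.continuousAt
  · have h1 : Set.range E.pt ∈ f := by
      rw [← E.compl_range_incl]
      exact Ultrafilter.compl_mem_iff_notMem.2 hf
    obtain ⟨z, -, hz⟩ := isCompact_iff_ultrafilter_le_nhds.1 (Set.finite_range E.pt).isCompact f
      (Filter.le_principal_iff.2 h1)
    exact ⟨z, trivial, hz⟩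

/-- An end eventually leaves a compact neighbourhood of `x`, because it is finer than `cocompact`.
-/
theorem disjoint_nhds_incl_pt [T2Space X] (x : X) (j : J) :
    Disjoint (𝓝 (E.incl x)) (𝓝 (E.pt j)) := by
  have := ChartedSpace.locallyCompactSpace ℂ X
  obtain ⟨K, hK, hxK⟩ := exists_compact_mem_nhds x
  have h1 : Kᶜ ∈ Filter.map (E.param j) (𝓝[≠] 0) :=
    (E.cocompact ▸ le_iSup (fun j => Filter.map (E.param j) (𝓝[≠] 0)) j :
      Filter.map (E.param j) (𝓝[≠] 0) ≤ Filter.cocompact X) hK.compl_mem_cocompact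
  refine Filter.disjoint_iff.2 ⟨_, E.isOpenEmbedding_incl.image_mem_nhds.2 hxK,
    (E.incl '' K)ᶜ, E.mem_nhds_pt.2 ⟨?_, ?_⟩, disjoint_compl_right⟩
  · rintro ⟨y, -, hy⟩
    exact E.incl_ne_pt y j hy
  · refine Filter.mem_of_superset h1 ?_
    rintro t ht ⟨y, hy, hyt⟩
    exact ht (E.incl_injective hyt ▸ hy)

instance [T2Space X] : T2Space E.Completion := by
  rw [t2Space_iff_disjoint_nhds]
  intro z z' hne
  show Disjoint _ _
  rcases E.eq_incl_or_eq_pt z with ⟨x, rfl⟩ | ⟨j, rfl⟩ <;>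
    rcases E.eq_incl_or_eq_pt z' with ⟨x', rfl⟩ | ⟨j', rfl⟩
  · rw [← E.isOpenEmbedding_incl.map_nhds_eq, ← E.isOpenEmbedding_incl.map_nhds_eq,
      Filter.disjoint_map E.incl_injective]
    exact disjoint_nhds_nhds.2 fun h => hne (congrArg _ h)
  · exact E.disjoint_nhds_incl_pt x j'
  · exact (E.disjoint_nhds_incl_pt x' j).symm
  · have hjj : j ≠ j' := fun h => hne (congrArg _ h)
    obtain ⟨s, hs, s', hs', hd⟩ := Filter.disjoint_iff.1 (E.disjoint j j' hjj)
    refine Filter.disjoint_iff.2 ⟨insert (E.pt j) (E.incl '' s),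
      E.mem_nhds_pt.2 ⟨Set.mem_insert _ _, ?_⟩, insert (E.pt j') (E.incl '' s'),
      E.mem_nhds_pt.2 ⟨Set.mem_insert _ _, ?_⟩, ?_⟩
    · exact Filter.mem_of_superset hs fun t ht => Or.inr ⟨_, ht, rfl⟩
    · exact Filter.mem_of_superset hs' fun t ht => Or.inr ⟨_, ht, rfl⟩
    · rw [Set.disjoint_left]
      rintro _ (rfl | ⟨y, hy, rfl⟩) (h | ⟨y', hy', h⟩)
      · exact hne h
      · exact E.incl_ne_pt _ _ h
      · exact E.incl_ne_pt _ _ h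
      · exact Set.disjoint_left.1 hd hy (E.incl_injective h ▸ hy')

/-- The extension of a function on the surface by `0` at the added points. -/
def extendZero (f : X → ℂ) : E.Completion → ℂ := Sum.elim f fun _ => 0

theorem continuousAt_extendZero {f : X → ℂ} {x : X} (hf : ContinuousAt f x) :
    ContinuousAt (E.extendZero f) (E.incl x) :=
  (E.isOpenEmbedding_incl.continuousAt_iff (f := E.incl) (g := E.extendZero f)).1 hf

/-- A chart of the surface as a chart of its completion. -/
noncomputable def inclChart (c : OpenPartialHomeomorph X ℂ) : OpenPartialHomeomorph E.Completion ℂ where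
  toFun := E.extendZero c
  invFun t := E.incl (c.symm t)
  source := E.incl '' c.source
  target := c.target
  map_source' := by
    rintro _ ⟨x, hx, rfl⟩
    exact c.map_source hx
  map_target' t ht := ⟨_, c.map_target ht, rfl⟩
  left_inv' := by
    rintro _ ⟨x, hx, rfl⟩
    exact congrArg E.incl (c.left_inv hx)
  right_inv' t ht := c.right_inv ht
  open_source := E.isOpenEmbedding_incl.isOpenMap _ c.open_source
  open_target := c.open_target
  continuousOn_toFun := by
    rintro _ ⟨x, hx, rfl⟩
    exact (E.continuousAt_extendZero (c.continuousAt hx)).continuousWithinAt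
  continuousOn_invFun := E.isOpenEmbedding_incl.continuous.comp_continuousOn c.continuousOn_symm

open Classical in
/-- The chart at an added point. -/
noncomputable def ptChart (j : J) : OpenPartialHomeomorph E.Completion ℂ where
  toFun := E.extendZero (E.param j).symm
  invFun t := if t = 0 then E.pt j else E.incl (E.param j t)
  source := insert (E.pt j) (E.incl '' (E.param j).target)
  target := insert 0 (E.param j).source
  map_source' := by
    rintro _ (rfl | ⟨x, hx, rfl⟩)
    · exact Or.inl rfl
    · exact Or.inr ((E.param j).map_target hx)
  map_target' t ht := by
    by_cases h : t = 0
    · simp [h]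
    · rw [if_neg h]
      exact Or.inr ⟨_, (E.param j).map_source (ht.resolve_left h), rfl⟩
  left_inv' := by
    rintro _ (rfl | ⟨x, hx, rfl⟩)
    · exact if_pos rfl
    · have h : (E.param j).symm x ≠ 0 := fun h => E.zero_notMem j (h ▸ (E.param j).map_target hx)
      exact (if_neg h).trans (congrArg E.incl ((E.param j).right_inv hx))
  right_inv' t ht := by
    by_cases h : t = 0
    · rw [if_pos h]
      exact h.symm
    · rw [if_neg h]
      exact (E.param j).left_inv (ht.resolve_left h)
  open_source := by
    rw [isOpen_iff_mem_nhds]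
    rintro _ (rfl | ⟨x, hx, rfl⟩)
    · refine E.mem_nhds_pt.2 ⟨Set.mem_insert _ _, ?_⟩
      filter_upwards [E.source_mem j] with t ht
      exact Or.inr ⟨_, (E.param j).map_source ht, rfl⟩
    · exact Filter.mem_of_superset (E.isOpenEmbedding_incl.image_mem_nhds.2
        ((E.param j).open_target.mem_nhds hx)) (Set.subset_insert _ _)
  open_target := by
    rw [isOpen_iff_mem_nhds]
    rintro t (rfl | ht)
    · exact insert_mem_nhds_iff.2 (E.source_mem j)
    · exact Filter.mem_of_superset ((E.param j).open_source.mem_nhds ht) (Set.subset_insert _ _)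
  continuousOn_toFun := by
    rintro _ (rfl | ⟨x, hx, rfl⟩)
    · refine ContinuousAt.continuousWithinAt ?_
      intro N hN
      have hN' : N ∈ 𝓝 (0 : ℂ) := hN
      have h0N : (0 : ℂ) ∈ N := mem_of_mem_nhds hN'
      refine E.mem_nhds_pt.2 ⟨h0N, ?_⟩
      filter_upwards [mem_nhdsWithin_of_mem_nhds hN', E.source_mem j] with t ht hts
      show (E.param j).symm (E.param j t) ∈ N
      rwa [(E.param j).left_inv hts]
    · exact (E.continuousAt_extendZero
        ((E.param j).continuousAt_symm hx)).continuousWithinAt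
  continuousOn_invFun := by
    rintro t (rfl | ht)
    · refine ContinuousAt.continuousWithinAt ?_
      intro U hU
      simp only [if_true] at hU
      have hU' := E.mem_nhds_pt.1 hU
      refine Filter.mem_map.2 ?_
      filter_upwards [eventually_nhdsWithin_iff.1 hU'.2] with t ht
      by_cases h : t = 0
      · simpa [h] using hU'.1
      · simpa [h] using ht h
    · refine ContinuousAt.continuousWithinAt ?_
      have ht0 : t ≠ 0 := fun h => E.zero_notMem j (h ▸ ht)
      refine (E.isOpenEmbedding_incl.continuous.continuousAt.comp
        ((E.param j).continuousAt ht)).congr ?_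
      filter_upwards [isOpen_ne.mem_nhds ht0] with s hs
      exact (if_neg hs).symm

noncomputable instance : ChartedSpace ℂ E.Completion where
  atlas := (Set.range fun x => E.inclChart (chartAt ℂ x)) ∪ Set.range E.ptChart
  chartAt := Sum.elim (fun x => E.inclChart (chartAt ℂ x)) E.ptChart
  mem_chart_source := by
    rintro (x | j)
    · exact ⟨x, mem_chart_source ℂ x, rfl⟩
    · exact Or.inl rfl
  chart_mem_atlas := by
    rintro (x | j)
    · exact Or.inl ⟨x, rfl⟩
    · exact Or.inr ⟨j, rfl⟩

variable [IsManifold 𝓘(ℂ, ℂ) 1 X]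

/-- The charts of the completion at points of the surface come from holomorphic charts. -/
theorem exists_chart_of_mem_atlas {c : OpenPartialHomeomorph E.Completion ℂ}
    (hc : c ∈ atlas ℂ E.Completion) {x : X} (hx : E.incl x ∈ c.source) :
    ∃ d : OpenPartialHomeomorph X ℂ, d.MDifferentiable 𝓘(ℂ, ℂ) 𝓘(ℂ, ℂ) ∧ x ∈ d.source ∧
      (∀ y, c (E.incl y) = d y) ∧ ∀ᶠ t in 𝓝 (d x), c.symm t = E.incl (d.symm t) := by
  rcases hc with ⟨y, rfl⟩ | ⟨j, rfl⟩
  · obtain ⟨x', hx', h⟩ := hx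
    obtain rfl := E.incl_injective h
    exact ⟨chartAt ℂ y, mdifferentiable_chart y, hx', fun _ => rfl,
      Filter.Eventually.of_forall fun _ => rfl⟩
  · obtain ⟨x', hx', h⟩ := hx.resolve_left (E.incl_ne_pt x j)
    obtain rfl := E.incl_injective h
    refine ⟨(E.param j).symm, (E.mdifferentiable j).symm, hx', fun _ => rfl, ?_⟩
    have h0 : (E.param j).symm x' ≠ 0 := fun h => E.zero_notMem j (h ▸ (E.param j).map_target hx')
    filter_upwards [isOpen_ne.mem_nhds h0] with t ht
    exact if_neg ht

omit [IsManifold 𝓘(ℂ, ℂ) 1 X] in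
-- Only one chart sees an added point, so there the coordinate change is the identity and no
-- holomorphy across the puncture has to be checked.
theorem eq_ptChart_of_mem_source {c : OpenPartialHomeomorph E.Completion ℂ}
    (hc : c ∈ atlas ℂ E.Completion) {j : J} (hj : E.pt j ∈ c.source) : c = E.ptChart j := by
  rcases hc with ⟨y, rfl⟩ | ⟨k, rfl⟩
  · obtain ⟨x, -, hx⟩ := hj
    exact (E.incl_ne_pt x j hx).elim
  · rcases hj with h | ⟨x, -, hx⟩
    · rw [E.pt_injective h]
    · exact (E.incl_ne_pt x j hx).elim

instance : IsManifold 𝓘(ℂ, ℂ) 1 E.Completion := by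
  refine isManifold_of_contDiffOn 𝓘(ℂ, ℂ) 1 E.Completion fun c c' hc hc' => ?_
  simp only [modelWithCornersSelf_coe, modelWithCornersSelf_coe_symm, Function.comp_id,
    Function.id_comp, Set.preimage_id, Set.range_id, Set.inter_univ]
  -- Over `ℂ`, differentiability on an open set already gives continuous differentiability.
  refine DifferentiableOn.contDiffOn (fun t ht => ?_) (c.symm.trans c').open_source
  refine DifferentiableAt.differentiableWithinAt ?_
  have ht1 : t ∈ c.target := ht.1
  have ht2 : c.symm t ∈ c'.source := ht.2
  have hts : c.symm t ∈ c.source := c.map_target ht1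
  rcases E.eq_incl_or_eq_pt (c.symm t) with ⟨x, hx⟩ | ⟨j, hj⟩
  · rw [hx] at ht2 hts
    obtain ⟨d, hd, hxd, hcd, hd'⟩ := E.exists_chart_of_mem_atlas hc hts
    obtain ⟨d₂, hd₂, hxd₂, hcd₂, -⟩ := E.exists_chart_of_mem_atlas hc' ht2
    have hdx : d x = t := by rw [← hcd, ← hx, c.right_inv ht1]
    rw [hdx] at hd'
    have hsymm : d.symm t = x := by rw [← hdx, d.left_inv hxd]
    have htd : t ∈ d.target := hdx ▸ d.map_source hxd
    have h1 : DifferentiableAt ℂ (d₂ ∘ d.symm) t := by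
      rw [← mdifferentiableAt_iff_differentiableAt]
      exact (hd₂.mdifferentiableAt (by rwa [hsymm])).comp t (hd.mdifferentiableAt_symm htd)
    refine h1.congr_of_eventuallyEq ?_
    filter_upwards [hd'] with s hs
    show c' (c.symm s) = d₂ (d.symm s)
    rw [hs, hcd₂]
  · rw [hj] at ht2 hts
    obtain rfl := E.eq_ptChart_of_mem_source hc hts
    obtain rfl := E.eq_ptChart_of_mem_source hc' ht2
    refine differentiableAt_id.congr_of_eventuallyEq ?_
    filter_upwards [(E.ptChart j).open_target.mem_nhds ht1] with s hs
    exact (E.ptChart j).right_inv hs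

theorem mdifferentiable_incl : MDifferentiable 𝓘(ℂ, ℂ) 𝓘(ℂ, ℂ) E.incl := by
  intro x
  have hmem : E.inclChart (chartAt ℂ x) ∈ atlas ℂ E.Completion := Or.inl ⟨x, rfl⟩
  have hx := mem_chart_source ℂ x
  have h1 := (mdifferentiableAt_atlas_symm (I := 𝓘(ℂ, ℂ)) hmem
    (x := chartAt ℂ x x) (mem_chart_target ℂ x)).comp x
    ((mdifferentiable_chart (I := 𝓘(ℂ, ℂ)) x).mdifferentiableAt hx)
  refine h1.congr_of_eventuallyEq ?_
  filter_upwards [(chartAt ℂ x).open_source.mem_nhds hx] with z hz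
  exact (congrArg E.incl ((chartAt ℂ x).left_inv hz)).symm

end PuncturedEnds

/-! ### Components of a punctured compact surface -/

section Opens

variable {X Y Z : Type*} [TopologicalSpace X] [ChartedSpace ℂ X] [TopologicalSpace Y]
  [ChartedSpace ℂ Y] [TopologicalSpace Z] [ChartedSpace ℂ Z]

theorem mdifferentiable_opens_val [IsManifold 𝓘(ℂ, ℂ) 1 X] (U : TopologicalSpace.Opens X) :
    MDifferentiable 𝓘(ℂ, ℂ) 𝓘(ℂ, ℂ) (Subtype.val : U → X) :=
  (contMDiff_subtype_val (n := 1)).mdifferentiable one_ne_zero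

/-- The inclusion of `U` is holomorphic and injective, hence a local biholomorphism, and holomorphy
can be tested after composing with it. -/
theorem mdifferentiable_opens_codRestrict [IsManifold 𝓘(ℂ, ℂ) 1 X]
    (U : TopologicalSpace.Opens X) {f : Z → U}
    (hf : MDifferentiable 𝓘(ℂ, ℂ) 𝓘(ℂ, ℂ) (fun z => (f z : X))) :
    MDifferentiable 𝓘(ℂ, ℂ) 𝓘(ℂ, ℂ) f := by
  intro z
  obtain ⟨e, hx, he, hee⟩ := (mdifferentiable_opens_val U).exists_localBiholomorphism_of_injOn
    (Filter.univ_mem : Set.univ ∈ 𝓝 (f z)) Subtype.val_injective.injOn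
  exact mdifferentiableAt_of_localBiholomorphism_comp he hx hee
    (Topology.IsInducing.subtypeVal.continuous_iff.2 hf.continuous).continuousAt (hf z)

/-- A component of a punctured compact surface is a punctured compact connected surface. -/
theorem exists_isPunctureCompactification_component {X : Type v} [TopologicalSpace X]
    [ChartedSpace ℂ X] [IsManifold 𝓘(ℂ, ℂ) 1 X] {C : Type w} [TopologicalSpace C]
    [ChartedSpace ℂ C] [IsManifold 𝓘(ℂ, ℂ) 1 C] [T2Space C] [CompactSpace C] {ι : X → C}
    (hι : Topology.IsOpenEmbedding ι) (hιd : MDifferentiable 𝓘(ℂ, ℂ) 𝓘(ℂ, ℂ) ι)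
    (hιf : (Set.range ι)ᶜ.Finite) (x : X) (U : TopologicalSpace.Opens X)
    (hU : (U : Set X) = connectedComponent x) :
    ∃ (R : Type w) (_ : TopologicalSpace R) (_ : ChartedSpace ℂ R),
      ClosedRiemannSurface R ∧ IsPunctureCompactification U R := by
  have : LocallyConnectedSpace C := ChartedSpace.locallyConnectedSpace ℂ C
  set R : TopologicalSpace.Opens C := ⟨connectedComponent (ι x), isOpen_connectedComponent⟩ with hR
  have hconn : ConnectedSpace R := isConnected_iff_connectedSpace.1 isConnected_connectedComponent
  have hcomp : CompactSpace R :=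
    isCompact_iff_compactSpace.1 (isClosed_connectedComponent (x := ι x)).isCompact
  have hmaps : ∀ z : U, ι z ∈ R := by
    intro z
    have hz : (z : X) ∈ connectedComponent x := hU ▸ z.2
    exact hι.continuous.image_connectedComponent_subset x ⟨z, hz, rfl⟩
  have hιU : Topology.IsOpenEmbedding (fun z : U => ι z) := hι.comp U.2.isOpenEmbedding_subtypeVal
  refine ⟨R, inferInstance, inferInstance, { }, fun z => ⟨ι z, hmaps z⟩, ?_, ?_, ?_⟩
  · exact Topology.IsOpenEmbedding.of_comp (f := fun z : U => (⟨ι z, hmaps z⟩ : R))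
      (g := Subtype.val) R.2.isOpenEmbedding_subtypeVal hιU
  · exact mdifferentiable_opens_codRestrict R (hιd.comp (mdifferentiable_opens_val U))
  · have hfin : (Subtype.val ⁻¹' (Set.range ι)ᶜ : Set R).Finite :=
      hιf.preimage Subtype.val_injective.injOn
    refine hfin.subset ?_
    rintro r hr ⟨z, hz⟩
    apply hr
    -- Removing finitely many points leaves the component `R` of `C` connected. So the part of `X`
    -- lying in `R` is connected and contains `x`: it is the component of `x`, and `R` has no other
    -- points of `X`.
    have hpre : IsPreconnected (ι ⁻¹' (Subtype.val '' (Subtype.val ⁻¹' (Set.range ι)ᶜ : Set R)ᶜ)) := by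
      refine IsPreconnected.preimage_of_isOpenMap
        ((isPreconnected_compl_of_finite hfin).image _ continuous_subtype_val.continuousOn)
        hι.injective hι.isOpenMap ?_
      rintro _ ⟨s, hs, rfl⟩
      exact not_not.1 hs
    have hzU : z ∈ U := by
      show z ∈ (U : Set X)
      rw [hU]
      refine hpre.subset_connectedComponent ?_ ?_
      · exact ⟨⟨ι x, mem_connectedComponent⟩, fun h => h ⟨x, rfl⟩, rfl⟩
      · exact ⟨r, fun h => h ⟨z, hz⟩, hz.symm⟩
    exact ⟨⟨z, hzU⟩, Subtype.ext hz⟩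

end Opens

/-! ### Transitive deck maps, from regularity or from a normal subgroup -/

/-- The maps of `S` over `S₀` that are homeomorphisms over `V` act transitively on the fibres
over `V`. -/
def HasTransitiveDeckMaps {S S₀ : Type*} [TopologicalSpace S] (β : S → S₀) (V : Set S₀) : Prop :=
  ∀ a a', β a ∈ V → β a = β a' → ∃ f g : S → S, ContinuousOn f (β ⁻¹' V) ∧
    ContinuousOn g (β ⁻¹' V) ∧ (∀ z ∈ β ⁻¹' V, β (f z) = β z) ∧ (∀ z ∈ β ⁻¹' V, β (g z) = β z) ∧
    (∀ z ∈ β ⁻¹' V, g (f z) = z) ∧ (∀ z ∈ β ⁻¹' V, f (g z) = z) ∧ f a = a'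

theorem IsRegularBranchedCover.hasTransitiveDeckMaps {S S₀ : Type*} [TopologicalSpace S]
    [ChartedSpace ℂ S] [TopologicalSpace S₀] [ChartedSpace ℂ S₀] {β : HolomorphicMap S S₀}
    (hβ : IsRegularBranchedCover β) (V : Set S₀) : HasTransitiveDeckMaps β V := by
  intro a a' _ h
  obtain ⟨φ, -, hφβ, hφ⟩ := hβ.2 a a' h
  refine ⟨φ, φ.symm, φ.continuous.continuousOn, φ.symm.continuous.continuousOn,
    fun z _ => hφβ z, fun z _ => ?_, fun z _ => φ.symm_apply_apply z,
    fun z _ => φ.apply_symm_apply z, hφ⟩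
  rw [← hφβ, φ.apply_symm_apply]

/-- If `U / N` is a normal covering, then the elements of the ambient group act on it. -/
theorem RealizesQuotient.exists_deckMap {U S G : Type*} [TopologicalSpace U] [ChartedSpace ℂ U]
    [TopologicalSpace S] [ChartedSpace ℂ S] [Group G] [MulAction G U] {N : Subgroup G}
    (hN : N.Normal) {p : HolomorphicMap U S} {W : Set S} (hp : RealizesQuotient N p W)
    (hG : ∀ g : G, Continuous fun u : U => g • u) (g : G) :
    ∃ f : S → S, ContinuousOn f W ∧ ∀ u, f (p u) = p (g • u) := by
  classical
  obtain ⟨-, hW, hq⟩ := hp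
  have hsurj : ∀ a ∈ W, ∃ u, p u = a := fun a ha => by
    obtain ⟨u, hu⟩ := hq.surjective ⟨a, ha⟩
    exact ⟨u, congrArg Subtype.val hu⟩
  rcases isEmpty_or_nonempty U with hU | hU
  · exact ⟨id, continuousOn_id, fun u => isEmptyElim u⟩
  choose! s hs using hsurj
  have hf : ∀ u, p (g • s (p u)) = p (g • u) := by
    intro u
    have h1 : W.codRestrict p hW (s (p u)) = W.codRestrict p hW u := Subtype.ext (hs _ (hW u))
    obtain ⟨n, hn⟩ := hq.apply_eq_iff_mem_orbit.1 h1
    have hn' : (n : G) • u = s (p u) := hn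
    have h2 : W.codRestrict p hW (g • s (p u)) = W.codRestrict p hW (g • u) := by
      -- The chosen lift `s (p u)` is `n • u`, so the two translates by `g` differ by the conjugate
      -- `g * n * g⁻¹`, which normality puts in `N`.
      refine hq.apply_eq_iff_mem_orbit.2 ⟨⟨g * n * g⁻¹, hN.conj_mem n n.2 g⟩, ?_⟩
      show (g * n * g⁻¹) • g • u = g • s (p u)
      rw [← hn', smul_smul, smul_smul]
      simp
    exact congrArg Subtype.val h2
  refine ⟨fun a => p (g • s a), ?_, hf⟩
  -- The section `s` is not continuous, but continuity may be checked on `U`, where the map becomes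
  -- `u ↦ p (g • u)`.
  rw [continuousOn_iff_continuous_domRestrict, hq.toIsQuotientMap.continuous_iff]
  refine (p.holomorphic.continuous.comp (hG g)).congr fun u => (hf u).symm

/-- Lifts of two points in a fibre of `β` have the same image under `p₀`, so some `g : G` moves one
to the other. The maps induced by `g` and `g⁻¹` are mutually inverse. -/
theorem RealizesQuotient.hasTransitiveDeckMaps {U S S₀ G : Type*} [TopologicalSpace U]
    [ChartedSpace ℂ U] [TopologicalSpace S] [ChartedSpace ℂ S] [TopologicalSpace S₀]
    [ChartedSpace ℂ S₀] [Group G] [MulAction G U] {N : Subgroup G} (hN : N.Normal)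
    {β : HolomorphicMap S S₀} {V : Set S₀} {p₀ : HolomorphicMap U S₀} {p : HolomorphicMap U S}
    (hp₀ : RealizesQuotient G p₀ V) (hp : RealizesQuotient N p (β ⁻¹' V))
    (hβ : ∀ u, β (p u) = p₀ u) : HasTransitiveDeckMaps β V := by
  intro a a' ha haa'
  have hsurj : ∀ a ∈ β ⁻¹' V, ∃ u, p u = a := fun a ha => by
    obtain ⟨-, hW, hq⟩ := hp
    obtain ⟨u, hu⟩ := hq.surjective ⟨a, ha⟩
    exact ⟨u, congrArg Subtype.val hu⟩
  have hp₀s : ∀ (g : G) u, p₀ (g • u) = p₀ u := fun g u => by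
    obtain ⟨-, hW, hq⟩ := hp₀
    exact congrArg Subtype.val (hq.map_smul g (e := u))
  obtain ⟨u, rfl⟩ := hsurj a ha
  obtain ⟨u', rfl⟩ := hsurj a' (by rwa [Set.mem_preimage, ← haa'])
  obtain ⟨g, hg⟩ : ∃ g : G, g • u = u' := by
    obtain ⟨-, hW, hq⟩ := hp₀
    have h1 : V.codRestrict p₀ hW u' = V.codRestrict p₀ hW u := Subtype.ext (by
      rw [hβ, hβ] at haa'
      exact haa'.symm)
    exact hq.apply_eq_iff_mem_orbit.1 h1
  have hG : ∀ g : G, Continuous fun u : U => g • u := fun g => (hp₀.1 g).continuous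
  obtain ⟨f, hfc, hf⟩ := hp.exists_deckMap hN hG g
  obtain ⟨f', hfc', hf'⟩ := hp.exists_deckMap hN hG g⁻¹
  refine ⟨f, f', hfc, hfc', ?_, ?_, ?_, ?_, by rw [hf, hg]⟩ <;>
  · intro z hz
    obtain ⟨y, rfl⟩ := hsurj z hz
    simp [hf, hf', hβ, hp₀s]

/-! ### Isomorphisms between components of the unbranched fibre product -/

namespace FiberProductStar

variable {S₀ S₁ S₂ : Type*}
  [TopologicalSpace S₀] [ChartedSpace ℂ S₀] [ClosedRiemannSurface S₀]
  [TopologicalSpace S₁] [ChartedSpace ℂ S₁] [ClosedRiemannSurface S₁]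
  [TopologicalSpace S₂] [ChartedSpace ℂ S₂] [ClosedRiemannSurface S₂]
  {β₁ : HolomorphicMap S₁ S₀} {β₂ : HolomorphicMap S₂ S₀}

omit [ClosedRiemannSurface S₀] [ClosedRiemannSurface S₁] [ClosedRiemannSurface S₂] in
theorem isInducing_val :
    Topology.IsInducing (fun z : FiberProductStar β₁ β₂ => (z.1 : S₁ × S₂)) :=
  Topology.IsInducing.subtypeVal

/-- In the defining charts this projection is the identity. -/
theorem mdifferentiable_fst :
    MDifferentiable 𝓘(ℂ, ℂ) 𝓘(ℂ, ℂ) (fst (β₁ := β₁) (β₂ := β₂)) := by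
  intro x
  have hx : x ∈ (chartAt ℂ x).source := mem_chart_source ℂ x
  have hxt : chartAt ℂ x x ∈ (chartAt ℂ x.fst).target := by
    have : chartAt ℂ x x = chartAt ℂ x.fst x.fst :=
      congrArg (chartAt ℂ x.fst) (localFst_apply x x)
    rw [this]
    exact mem_chart_target ℂ x.fst
  have h1 := ((mdifferentiable_chart (I := 𝓘(ℂ, ℂ)) x.fst).mdifferentiableAt_symm hxt).comp x
    ((mdifferentiable_chart (I := 𝓘(ℂ, ℂ)) x).mdifferentiableAt hx)
  refine h1.congr_of_eventuallyEq ?_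
  filter_upwards [(chartAt ℂ x).open_source.mem_nhds hx] with z hz
  have hz1 : z ∈ ((localFst x).trans (chartAt ℂ x.fst)).source := hz
  rw [OpenPartialHomeomorph.trans_source] at hz1
  have h2 : chartAt ℂ x z = chartAt ℂ x.fst z.fst :=
    congrArg (chartAt ℂ x.fst) (localFst_apply x z)
  have h3 : z.fst ∈ (chartAt ℂ x.fst).source := localFst_apply x z ▸ hz1.2
  show z.fst = (chartAt ℂ x.fst).symm (chartAt ℂ x z)
  rw [h2, (chartAt ℂ x.fst).left_inv h3]

/-- The projection to `S₀`. -/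
def proj (z : FiberProductStar β₁ β₂) : S₀ := β₁ z.fst

theorem mdifferentiable_proj :
    MDifferentiable 𝓘(ℂ, ℂ) 𝓘(ℂ, ℂ) (proj (β₁ := β₁) (β₂ := β₂)) :=
  β₁.holomorphic.comp mdifferentiable_fst

omit [ClosedRiemannSurface S₀] [ClosedRiemannSurface S₁] [ClosedRiemannSurface S₂] in
theorem fst_not_critical (z : FiberProductStar β₁ β₂) : z.fst ∉ β₁.criticalPoints :=
  fun h => z.2.2 (Or.inl ⟨z.fst, h, rfl⟩)

/-- The projection to `S₀` is a local biholomorphism. -/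
theorem exists_localBiholomorphism_proj (x : FiberProductStar β₁ β₂) :
    ∃ e : OpenPartialHomeomorph (FiberProductStar β₁ β₂) S₀, x ∈ e.source ∧
      e.MDifferentiable 𝓘(ℂ, ℂ) 𝓘(ℂ, ℂ) ∧ Set.EqOn proj e e.source := by
  obtain ⟨e, hxe, hee⟩ := β₁.exists_localInverse (fst_not_critical x)
  -- The local inverses of the two factors are only topological. They give injectivity near `x`, and
  -- for a holomorphic map that suffices.
  refine mdifferentiable_proj.exists_localBiholomorphism_of_injOn
    (Filter.inter_mem ((localFst x).open_source.mem_nhds (mem_localFst_source x))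
      ((e.open_source.preimage continuous_fst).mem_nhds hxe)) ?_
  rintro z ⟨hz, hze⟩ z' ⟨hz', hze'⟩ h
  refine (localFst x).injOn hz hz' ?_
  rw [localFst_apply, localFst_apply]
  exact e.injOn hze hze' (by rw [← hee hze, ← hee hze']; exact h)

/-- A continuous map to the fibre product is holomorphic if its projection to `S₀` is. -/
theorem mdifferentiableAt_of_proj {Z : Type*} [TopologicalSpace Z] [ChartedSpace ℂ Z]
    {f : Z → FiberProductStar β₁ β₂} {z : Z} (hf : ContinuousAt f z)
    (h : MDifferentiableAt 𝓘(ℂ, ℂ) 𝓘(ℂ, ℂ) (proj ∘ f) z) :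
    MDifferentiableAt 𝓘(ℂ, ℂ) 𝓘(ℂ, ℂ) f z := by
  obtain ⟨e, hx, he, hee⟩ := exists_localBiholomorphism_proj (f z)
  exact mdifferentiableAt_of_localBiholomorphism_comp he hx hee hf h

theorem isOpenMap_fst : IsOpenMap (fst (β₁ := β₁) (β₂ := β₂)) :=
  (IsLocalHomeomorph.mk _ fun x =>
    ⟨localFst x, mem_localFst_source x, fun z _ => (localFst_apply x z).symm⟩).isOpenMap

/-- The charts are built from the first projection, so the second is reached through `S₀`: both `β₂`
and `β₂ ∘ snd` are local homeomorphisms at the relevant points, hence so is `snd`. -/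
theorem isOpenMap_snd : IsOpenMap (snd (β₁ := β₁) (β₂ := β₂)) := by
  have h1 : IsLocalHomeomorphOn β₂ (snd (β₁ := β₁) (β₂ := β₂) '' Set.univ) := by
    refine IsLocalHomeomorphOn.mk _ _ ?_
    rintro _ ⟨x, -, rfl⟩
    exact β₂.exists_localInverse (snd_not_critical x)
  have h2 : IsLocalHomeomorphOn (β₂ ∘ snd (β₁ := β₁) (β₂ := β₂)) Set.univ := by
    refine IsLocalHomeomorphOn.mk _ _ fun x _ => ?_
    obtain ⟨e, hx, -, hee⟩ := exists_localBiholomorphism_proj x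
    exact ⟨e, hx, fun z hz => (comm z).symm.trans (hee hz)⟩
  exact (isLocalHomeomorph_iff_isLocalHomeomorphOn_univ.2
    (h2.of_comp_left h1 fun x _ => continuous_snd.continuousAt)).isOpenMap

omit [ClosedRiemannSurface S₁] [ClosedRiemannSurface S₂] in
theorem isClosed_fiberProduct : IsClosed (fiberProduct β₁ β₂) :=
  isClosed_eq (β₁.holomorphic.continuous.comp _root_.continuous_fst)
    (β₂.holomorphic.continuous.comp _root_.continuous_snd)

/-- Every component projects onto the unbranched part of each factor. -/
theorem exists_mem_connectedComponent {S : Type*} [TopologicalSpace S] [T2Space S]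
    {g : S₁ × S₂ → S} (hg : Continuous g) {A : Set S} (hA : IsPreconnected A)
    (hgA : ∀ z ∈ fiberProduct β₁ β₂, g z ∈ A ↔ β₁ z.1 ∉ branchSet β₁ β₂)
    (hopen : IsOpenMap fun z : FiberProductStar β₁ β₂ => g z.1) (x : FiberProductStar β₁ β₂)
    {b : S} (hb : b ∈ A) : ∃ z ∈ connectedComponent x, g z.1 = b := by
  set T : Set (FiberProductStar β₁ β₂) := connectedComponent x with hT
  -- Over `A` the closure `K` adds nothing to `T`, since components are closed. The image of `T`
  -- thus agrees on `A` with the compact set `g '' K`; being open too, it contains the connected set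
  -- `A`.
  set K : Set (S₁ × S₂) := closure (Subtype.val '' T) with hK
  have hKF : K ⊆ fiberProduct β₁ β₂ := by
    refine closure_minimal ?_ isClosed_fiberProduct
    rintro _ ⟨z, -, rfl⟩
    exact z.2.1
  have hgK : IsClosed (g '' K) := (isClosed_closure.isCompact.image hg).isClosed
  have hKA : ∀ z ∈ K, g z ∈ A → z ∈ Subtype.val '' T := by
    intro z hz hzA
    refine ⟨⟨z, hKF hz, (hgA z (hKF hz)).1 hzA⟩, ?_, rfl⟩
    have h1 : (⟨z, hKF hz, (hgA z (hKF hz)).1 hzA⟩ : FiberProductStar β₁ β₂) ∈ closure T := by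
      rw [isInducing_val.closure_eq_preimage_closure_image]
      exact hz
    rwa [(isClosed_connectedComponent (x := x)).closure_eq] at h1
  have hTK : (fun z : FiberProductStar β₁ β₂ => g z.1) '' T ⊆ g '' K := by
    rintro _ ⟨z, hz, rfl⟩
    exact ⟨z.1, subset_closure ⟨z, hz, rfl⟩, rfl⟩
  have hsub : A ⊆ (fun z : FiberProductStar β₁ β₂ => g z.1) '' T := by
    refine hA.subset_left_of_subset_union (hopen _ isOpen_connectedComponent)
      hgK.isOpen_compl (disjoint_compl_right.mono_left hTK) ?_ ?_
    · intro a ha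
      by_cases h : a ∈ g '' K
      · obtain ⟨z, hz, rfl⟩ := h
        obtain ⟨y, hy, rfl⟩ := hKA z hz ha
        exact Or.inl ⟨y, hy, rfl⟩
      · exact Or.inr h
    · exact ⟨g x.1, (hgA _ x.2.1).2 x.2.2, x, mem_connectedComponent, rfl⟩
  exact hsub hb

/-- A homeomorphism over `S₀` maps components to isomorphic components. -/
theorem biholomorphic_component (G H : S₁ × S₂ → S₁ × S₂)
    (hG : ∀ z : FiberProductStar β₁ β₂, ContinuousWithinAt G
      {z | z ∈ fiberProduct β₁ β₂ ∧ β₁ z.1 ∉ branchSet β₁ β₂} z.1)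
    (hH : ∀ z : FiberProductStar β₁ β₂, ContinuousWithinAt H
      {z | z ∈ fiberProduct β₁ β₂ ∧ β₁ z.1 ∉ branchSet β₁ β₂} z.1)
    (hGF : ∀ z : FiberProductStar β₁ β₂, G z.1 ∈ fiberProduct β₁ β₂)
    (hHF : ∀ z : FiberProductStar β₁ β₂, H z.1 ∈ fiberProduct β₁ β₂)
    (hGβ : ∀ z : FiberProductStar β₁ β₂, β₁ (G z.1).1 = β₁ z.1.1)
    (hHβ : ∀ z : FiberProductStar β₁ β₂, β₁ (H z.1).1 = β₁ z.1.1)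
    (hHG : ∀ z : FiberProductStar β₁ β₂, H (G z.1) = z.1)
    (hGH : ∀ z : FiberProductStar β₁ β₂, G (H z.1) = z.1)
    {x y z : FiberProductStar β₁ β₂} (hz : z ∈ connectedComponent x) (hzy : G z.1 = y.1) :
    Biholomorphic (component x) (component y) := by
  have hcont : ∀ {F : S₁ × S₂ → S₁ × S₂} (hF : ∀ z : FiberProductStar β₁ β₂, ContinuousWithinAt F
      {z | z ∈ fiberProduct β₁ β₂ ∧ β₁ z.1 ∉ branchSet β₁ β₂} z.1)
      {f : FiberProductStar β₁ β₂ → FiberProductStar β₁ β₂}, (∀ z, (f z).1 = F z.1) →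
      Continuous f := by
    intro F hF f hf
    refine isInducing_val.continuous_iff.2 ?_
    have h1 : ContinuousOn F {z | z ∈ fiberProduct β₁ β₂ ∧ β₁ z.1 ∉ branchSet β₁ β₂} :=
      fun z hz => hF ⟨z, hz⟩
    exact (continuousOn_iff_continuous_domRestrict.1 h1).congr fun z => (hf z).symm
  let φ : FiberProductStar β₁ β₂ ≃ₜ FiberProductStar β₁ β₂ :=
    { toFun := fun z => ⟨G z.1, hGF z, by rw [hGβ]; exact z.2.2⟩
      invFun := fun z => ⟨H z.1, hHF z, by rw [hHβ]; exact z.2.2⟩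
      left_inv := fun z => Subtype.ext (hHG z)
      right_inv := fun z => Subtype.ext (hGH z)
      continuous_toFun := hcont hG fun _ => rfl
      continuous_invFun := hcont hH fun _ => rfl }
  have hφz : φ z = y := Subtype.ext hzy
  -- `φ` commutes with the projection to `S₀`, a local biholomorphism, so its continuity is enough.
  have hφd : MDifferentiable 𝓘(ℂ, ℂ) 𝓘(ℂ, ℂ) φ := fun w =>
    mdifferentiableAt_of_proj φ.continuous.continuousAt
      ((mdifferentiable_proj w).congr_of_eventuallyEq (Filter.Eventually.of_forall hGβ))
  have hφd' : MDifferentiable 𝓘(ℂ, ℂ) 𝓘(ℂ, ℂ) φ.symm := fun w =>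
    mdifferentiableAt_of_proj φ.symm.continuous.continuousAt
      ((mdifferentiable_proj w).congr_of_eventuallyEq (Filter.Eventually.of_forall hHβ))
  have hxz : connectedComponent x = connectedComponent z := connectedComponent_eq hz
  have hiff : ∀ w, w ∈ component x ↔ φ w ∈ component y := by
    intro w
    show w ∈ connectedComponent x ↔ φ w ∈ connectedComponent y
    rw [hxz, ← hφz]
    constructor
    · exact fun h => φ.continuous.image_connectedComponent_subset z ⟨w, h, rfl⟩
    · intro h
      have := φ.symm.continuous.image_connectedComponent_subset (φ z) ⟨φ w, h, rfl⟩
      rwa [φ.symm_apply_apply, φ.symm_apply_apply] at this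
  refine ⟨φ.subtype hiff, ?_, ?_⟩
  · exact mdifferentiable_opens_codRestrict _ (hφd.comp (mdifferentiable_opens_val _))
  · exact mdifferentiable_opens_codRestrict _ (hφd'.comp (mdifferentiable_opens_val _))

/-- The component of `x` contains a point `z` with the same second coordinate as `y`. A deck map of
`β₁` that moves the first coordinate of `z` to that of `y`, paired with the identity of `S₂`,
carries `z` to `y`. -/
theorem biholomorphic_of_hasTransitiveDeckMaps_fst (hβ₁ : β₁.Nonconstant) (hβ₂ : β₂.Nonconstant)
    (h : HasTransitiveDeckMaps β₁ (branchSet β₁ β₂)ᶜ) (x y : FiberProductStar β₁ β₂) :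
    Biholomorphic (component x) (component y) := by
  have hA : IsPreconnected (β₂ ⁻¹' (branchSet β₁ β₂))ᶜ :=
    isPreconnected_compl_of_finite (hβ₂.finite_preimage (finite_branchSet hβ₁ hβ₂))
  obtain ⟨z, hz, hzy⟩ := exists_mem_connectedComponent (β₁ := β₁) (β₂ := β₂) (g := Prod.snd)
    _root_.continuous_snd hA
    (fun z hz => by
      have hz' : β₁ z.1 = β₂ z.2 := hz
      rw [hz']
      rfl) isOpenMap_snd x (b := y.snd)
    (by
      show ¬ β₂ y.snd ∈ branchSet β₁ β₂
      rw [← comm]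
      exact y.2.2)
  have hzy' : z.snd = y.snd := hzy
  obtain ⟨f, g, hf, hg, hfβ, hgβ, hgf, hfg, hfa⟩ := h z.fst y.fst z.2.2
    (by rw [comm, comm, hzy'])
  refine biholomorphic_component (Prod.map f id) (Prod.map g id) ?_ ?_ ?_ ?_ ?_ ?_ ?_ ?_ hz
    (Prod.ext hfa hzy)
  · intro z
    exact ((hf z.1.1 z.2.2).comp _root_.continuous_fst.continuousWithinAt fun w hw => hw.2).prodMk
      _root_.continuous_snd.continuousWithinAt
  · intro z
    exact ((hg z.1.1 z.2.2).comp _root_.continuous_fst.continuousWithinAt fun w hw => hw.2).prodMk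
      _root_.continuous_snd.continuousWithinAt
  · exact fun z => (hfβ z.1.1 z.2.2).trans z.2.1
  · exact fun z => (hgβ z.1.1 z.2.2).trans z.2.1
  · exact fun z => hfβ z.1.1 z.2.2
  · exact fun z => hgβ z.1.1 z.2.2
  · exact fun z => Prod.ext (hgf z.1.1 z.2.2) rfl
  · exact fun z => Prod.ext (hfg z.1.1 z.2.2) rfl

theorem biholomorphic_of_hasTransitiveDeckMaps_snd (hβ₁ : β₁.Nonconstant) (hβ₂ : β₂.Nonconstant)
    (h : HasTransitiveDeckMaps β₂ (branchSet β₁ β₂)ᶜ) (x y : FiberProductStar β₁ β₂) :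
    Biholomorphic (component x) (component y) := by
  have hA : IsPreconnected (β₁ ⁻¹' (branchSet β₁ β₂))ᶜ :=
    isPreconnected_compl_of_finite (hβ₁.finite_preimage (finite_branchSet hβ₁ hβ₂))
  obtain ⟨z, hz, hzy⟩ := exists_mem_connectedComponent (β₁ := β₁) (β₂ := β₂) (g := Prod.fst)
    _root_.continuous_fst hA (fun z hz => Iff.rfl) isOpenMap_fst x (b := y.fst) y.2.2
  have hzy' : z.fst = y.fst := hzy
  -- The unbranched part is defined through `β₁` of the first coordinate; here the condition is
  -- moved to `β₂` of the second.
  have hsnd : ∀ w ∈ {z : S₁ × S₂ | z ∈ fiberProduct β₁ β₂ ∧ β₁ z.1 ∉ branchSet β₁ β₂},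
      w.2 ∈ β₂ ⁻¹' (branchSet β₁ β₂)ᶜ := by
    rintro w ⟨hw, hw'⟩
    have hw1 : β₁ w.1 = β₂ w.2 := hw
    rwa [hw1] at hw'
  obtain ⟨f, g, hf, hg, hfβ, hgβ, hgf, hfg, hfa⟩ := h z.snd y.snd (hsnd _ z.2)
    (by rw [← comm, ← comm, hzy'])
  refine biholomorphic_component (Prod.map id f) (Prod.map id g) ?_ ?_ ?_ ?_ ?_ ?_ ?_ ?_ hz
    (Prod.ext hzy hfa)
  · intro z
    exact _root_.continuous_fst.continuousWithinAt.prodMk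
      ((hf z.1.2 (hsnd _ z.2)).comp _root_.continuous_snd.continuousWithinAt hsnd)
  · intro z
    exact _root_.continuous_fst.continuousWithinAt.prodMk
      ((hg z.1.2 (hsnd _ z.2)).comp _root_.continuous_snd.continuousWithinAt hsnd)
  · exact fun z => (comm z).trans (hfβ z.1.2 (hsnd _ z.2)).symm
  · exact fun z => (comm z).trans (hgβ z.1.2 (hsnd _ z.2)).symm
  · exact fun z => rfl
  · exact fun z => rfl
  · exact fun z => Prod.ext rfl (hgf z.1.2 (hsnd _ z.2))
  · exact fun z => Prod.ext rfl (hfg z.1.2 (hsnd _ z.2))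

end FiberProductStar

/-! ### Ends of the unbranched fibre product -/

/-- The curve `w ^ n = ζ ^ n * z ^ m`, with `m` and `n` coprime, is parametrized by
`t ↦ (t ^ n, ζ * t ^ m)`. -/
theorem zpow_mul_zpow_param {m n : ℕ} {a b : ℤ} (hab : a * m + b * n = 1) {ζ z w : ℂ}
    (hζ : ζ ≠ 0) (hz : z ≠ 0) (hw : w ≠ 0) (h : w ^ n = ζ ^ n * z ^ m) :
    (z ^ b * (w / ζ) ^ a) ^ n = z ∧ ζ * (z ^ b * (w / ζ) ^ a) ^ m = w := by
  have hv : w / ζ ≠ 0 := div_ne_zero hw hζ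
  -- With `v = w / ζ` the curve is `v ^ n = z ^ m`, and the parameter is `t = z ^ b * v ^ a`. The
  -- Bézout relation gives `t ^ n = z ^ (a * m + b * n) = z` and likewise `t ^ m = v`.
  have hvn : (w / ζ) ^ (n : ℤ) = z ^ (m : ℤ) := by
    rw [zpow_natCast, zpow_natCast, div_pow, h]
    field_simp
  generalize hvd : w / ζ = v at *
  have hw' : w = ζ * v := by rw [← hvd]; field_simp
  constructor
  · calc (z ^ b * v ^ a) ^ n = z ^ (b * n) * (v ^ (n : ℤ)) ^ a := by
          rw [mul_pow, ← zpow_natCast, ← zpow_natCast, ← zpow_mul, ← zpow_mul, ← zpow_mul,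
            mul_comm a]
      _ = z ^ (a * m + b * n) := by
          rw [hvn, ← zpow_mul, ← zpow_add₀ hz]
          congr 1
          ring
      _ = z := by rw [hab, zpow_one]
  · have h1 : (z ^ b * v ^ a) ^ m = v := by
      calc (z ^ b * v ^ a) ^ m = (z ^ (m : ℤ)) ^ b * v ^ (a * m) := by
            rw [mul_pow, ← zpow_natCast, ← zpow_natCast, ← zpow_mul, ← zpow_mul, ← zpow_mul,
              mul_comm b]
        _ = v ^ (a * m + b * n) := by
            rw [← hvn, ← zpow_mul, ← zpow_add₀ hv]
            congr 1
            ring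
        _ = v := by rw [hab, zpow_one]
    rw [h1, hw']

theorem zpow_mul_zpow_of_param {m n : ℕ} {a b : ℤ} (hab : a * m + b * n = 1) {ζ t : ℂ}
    (hζ : ζ ≠ 0) (ht : t ≠ 0) : (t ^ n) ^ b * (ζ * t ^ m / ζ) ^ a = t := by
  rw [mul_div_cancel_left₀ _ hζ, ← zpow_natCast, ← zpow_natCast, ← zpow_mul, ← zpow_mul,
    ← zpow_add₀ ht]
  conv_rhs => rw [← zpow_one t, ← hab]
  congr 1
  ring

namespace FiberProductStar

variable {S₀ : Type u₀} {S₁ : Type u₁} {S₂ : Type u₂}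
  [TopologicalSpace S₀] [ChartedSpace ℂ S₀] [TopologicalSpace S₁] [ChartedSpace ℂ S₁]
  [TopologicalSpace S₂] [ChartedSpace ℂ S₂]

/-- Coordinates near a point `p` of the fibre product over the branch set, in which the fibre
product is the curve `z ^ (m * d) = w ^ (n * d)`. -/
structure CrossingCoordinates (β₁ : HolomorphicMap S₁ S₀) (β₂ : HolomorphicMap S₂ S₀)
    (p : S₁ × S₂) where
  m : ℕ
  n : ℕ
  d : ℕ
  m_ne_zero : m ≠ 0
  n_ne_zero : n ≠ 0
  d_ne_zero : d ≠ 0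
  coprime : m.Coprime n
  φ₁ : OpenPartialHomeomorph S₁ ℂ
  φ₂ : OpenPartialHomeomorph S₂ ℂ
  mem_source₁ : p.1 ∈ φ₁.source
  mem_source₂ : p.2 ∈ φ₂.source
  apply₁ : φ₁ p.1 = 0
  apply₂ : φ₂ p.2 = 0
  mdifferentiable₁ : φ₁.MDifferentiable 𝓘(ℂ, ℂ) 𝓘(ℂ, ℂ)
  eq_iff : ∀ a ∈ φ₁.source, ∀ b ∈ φ₂.source, β₁ a = β₂ b ↔ φ₁ a ^ (m * d) = φ₂ b ^ (n * d)
  notMem_iff : ∀ a ∈ φ₁.source, β₁ a ∉ branchSet β₁ β₂ ↔ φ₁ a ≠ 0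
  ρ : ℝ
  ρ_pos : 0 < ρ
  ρ_le_one : ρ ≤ 1
  ball_subset₁ : Metric.ball 0 ρ ⊆ φ₁.target
  ball_subset₂ : Metric.ball 0 ρ ⊆ φ₂.target

/-- The power charts of `β₁` and `β₂` are taken over one chart of `S₀`, so that equality of images
becomes equality of powers. The exponents are then divided by their greatest common divisor `d`. -/
theorem nonempty_crossingCoordinates [ClosedRiemannSurface S₀] [ClosedRiemannSurface S₁]
    [ClosedRiemannSurface S₂] {β₁ : HolomorphicMap S₁ S₀} {β₂ : HolomorphicMap S₂ S₀}
    (hβ₁ : β₁.Nonconstant) (hβ₂ : β₂.Nonconstant) {p : S₁ × S₂} (hp : p ∈ fiberProduct β₁ β₂)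
    (hpB : β₁ p.1 ∈ branchSet β₁ β₂) : Nonempty (CrossingCoordinates β₁ β₂ p) := by
  have hp' : β₁ p.1 = β₂ p.2 := hp
  obtain ⟨M, hM, φ₁, hx₁, h01, hφ₁, h₁⟩ := β₁.holomorphic.exists_pow_chart
    (β₁.holomorphic.not_eventually_const hβ₁ p.1)
  obtain ⟨N, hN, φ₂, hx₂, h02, hφ₂, h₂⟩ := β₂.holomorphic.exists_pow_chart
    (β₂.holomorphic.not_eventually_const hβ₂ p.2)
  rw [← hp'] at h₂
  set ψ := chartAt ℂ (β₁ p.1) with hψ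
  obtain ⟨m, n, hmn, hm, hn⟩ := Nat.exists_coprime M N
  have hd : M.gcd N ≠ 0 := Nat.gcd_ne_zero_left hM
  set d := M.gcd N
  -- Excluding the finitely many other branch values makes `φ₁ a = 0` the only way for a point of
  -- the domain to lie over the branch set.
  set O : Set S₁ := β₁ ⁻¹' (branchSet β₁ β₂ \ {β₁ p.1})ᶜ with hO
  have hOo : IsOpen O := (((finite_branchSet hβ₁ hβ₂).subset
    Set.sdiff_subset).isClosed.isOpen_compl).preimage β₁.holomorphic.continuous
  have hxO : p.1 ∈ O := fun h => h.2 rfl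
  have h0t₁ : (0 : ℂ) ∈ (φ₁.restrOpen O hOo).target := by
    have := (φ₁.restrOpen O hOo).map_source (x := p.1) ⟨hx₁, hxO⟩
    rwa [show (φ₁.restrOpen O hOo) p.1 = 0 from h01] at this
  have h0t₂ : (0 : ℂ) ∈ φ₂.target := h02 ▸ φ₂.map_source hx₂
  obtain ⟨r, hr, hrs⟩ := Metric.mem_nhds_iff.1 (Filter.inter_mem
    ((φ₁.restrOpen O hOo).open_target.mem_nhds h0t₁) (φ₂.open_target.mem_nhds h0t₂))
  have hball : Metric.ball (0 : ℂ) (min r 1) ⊆ Metric.ball 0 r :=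
    Metric.ball_subset_ball (min_le_left _ _)
  refine ⟨{
    m := m
    n := n
    d := d
    m_ne_zero := by rintro rfl; simp at hm; exact hM hm
    n_ne_zero := by rintro rfl; simp at hn; exact hN hn
    d_ne_zero := hd
    coprime := hmn
    φ₁ := φ₁.restrOpen O hOo
    φ₂ := φ₂
    mem_source₁ := ⟨hx₁, hxO⟩
    mem_source₂ := hx₂
    apply₁ := h01
    apply₂ := h02
    mdifferentiable₁ := hφ₁.restrOpen O hOo
    eq_iff := ?_
    notMem_iff := ?_
    ρ := min r 1
    ρ_pos := lt_min hr one_pos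
    ρ_le_one := min_le_right _ _
    ball_subset₁ := fun t ht => (hrs (hball ht)).1
    ball_subset₂ := fun t ht => (hrs (hball ht)).2 }⟩
  · rintro a ⟨ha, -⟩ b hb
    rw [← hm, ← hn]
    show _ ↔ φ₁ a ^ M = φ₂ b ^ N
    rw [← ψ.injOn.eq_iff (h₁ a ha).1 (h₂ b hb).1, (h₁ a ha).2, (h₂ b hb).2, add_right_inj]
  · rintro a ⟨ha, haO⟩
    show _ ↔ φ₁ a ≠ 0
    have h3 : β₁ a = β₁ p.1 ↔ φ₁ a = 0 := by
      rw [← ψ.injOn.eq_iff (h₁ a ha).1 (mem_chart_source ℂ (β₁ p.1)), (h₁ a ha).2,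
        add_eq_left, pow_eq_zero_iff hM]
    rw [ne_eq, ← h3]
    constructor
    · intro h h'
      exact h (h' ▸ hpB)
    · intro h h'
      exact haO ⟨h', h⟩

namespace CrossingCoordinates

variable {β₁ : HolomorphicMap S₁ S₀} {β₂ : HolomorphicMap S₂ S₀} {p : S₁ × S₂}
  (C : CrossingCoordinates β₁ β₂ p)

/-- The parametrization of a branch of the fibre product. -/
noncomputable def pair (ζ t : ℂ) : S₁ × S₂ := (C.φ₁.symm (t ^ C.n), C.φ₂.symm (ζ * t ^ C.m))

theorem mul_pow_mem_ball {ζ t : ℂ} (hζ : ‖ζ‖ = 1) (ht : t ∈ Metric.ball 0 C.ρ) {k : ℕ}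
    (hk : k ≠ 0) : ζ * t ^ k ∈ Metric.ball 0 C.ρ := by
  rw [mem_ball_zero_iff] at ht ⊢
  rw [norm_mul, hζ, one_mul, norm_pow]
  -- The bound `ρ ≤ 1` ensures that taking powers does not leave the ball.
  exact (pow_le_of_le_one (norm_nonneg t) (ht.le.trans C.ρ_le_one) hk).trans_lt ht

theorem pow_mem_target₁ {t : ℂ} (ht : t ∈ Metric.ball 0 C.ρ) : t ^ C.n ∈ C.φ₁.target := by
  have := C.mul_pow_mem_ball norm_one ht C.n_ne_zero
  rw [one_mul] at this
  exact C.ball_subset₁ this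

theorem mul_pow_mem_target₂ {ζ t : ℂ} (hζ : ‖ζ‖ = 1) (ht : t ∈ Metric.ball 0 C.ρ) :
    ζ * t ^ C.m ∈ C.φ₂.target :=
  C.ball_subset₂ (C.mul_pow_mem_ball hζ ht C.m_ne_zero)

theorem continuousOn_pair {ζ : ℂ} (hζ : ‖ζ‖ = 1) :
    ContinuousOn (C.pair ζ) (Metric.ball 0 C.ρ) :=
  (C.φ₁.continuousOn_symm.comp (by fun_prop) fun _ ht => C.pow_mem_target₁ ht).prodMk
    (C.φ₂.continuousOn_symm.comp (by fun_prop) fun _ ht => C.mul_pow_mem_target₂ hζ ht)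

theorem pair_zero (ζ : ℂ) : C.pair ζ 0 = p := by
  refine Prod.ext ?_ ?_
  · show C.φ₁.symm (0 ^ C.n) = p.1
    rw [zero_pow C.n_ne_zero, ← C.apply₁, C.φ₁.left_inv C.mem_source₁]
  · show C.φ₂.symm (ζ * 0 ^ C.m) = p.2
    rw [zero_pow C.m_ne_zero, mul_zero, ← C.apply₂, C.φ₂.left_inv C.mem_source₂]

theorem pair_mem {ζ t : ℂ} (hζ : ‖ζ‖ = 1) (hζd : (ζ ^ C.n) ^ C.d = 1)
    (ht : t ∈ Metric.ball 0 C.ρ) (ht0 : t ≠ 0) :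
    C.pair ζ t ∈ fiberProduct β₁ β₂ ∧ β₁ (C.pair ζ t).1 ∉ branchSet β₁ β₂ := by
  have h1 := C.pow_mem_target₁ ht
  have h2 := C.mul_pow_mem_target₂ hζ ht
  refine ⟨(C.eq_iff _ (C.φ₁.map_target h1) _ (C.φ₂.map_target h2)).2 ?_,
    (C.notMem_iff _ (C.φ₁.map_target h1)).2 ?_⟩
  · rw [C.φ₁.right_inv h1, C.φ₂.right_inv h2, mul_pow, pow_mul ζ, hζd, one_mul, ← pow_mul,
      ← pow_mul]
    congr 1
    ring
  · rw [C.φ₁.right_inv h1]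
    exact pow_ne_zero _ ht0

theorem coord₁_ne_zero {z : FiberProductStar β₁ β₂} (h₁ : z.fst ∈ C.φ₁.source) :
    C.φ₁ z.fst ≠ 0 :=
  (C.notMem_iff _ h₁).1 z.2.2

theorem coord_pow_eq {z : FiberProductStar β₁ β₂} (h₁ : z.fst ∈ C.φ₁.source)
    (h₂ : z.snd ∈ C.φ₂.source) : C.φ₁ z.fst ^ (C.m * C.d) = C.φ₂ z.snd ^ (C.n * C.d) :=
  (C.eq_iff _ h₁ _ h₂).1 z.comm

theorem coord₂_ne_zero {z : FiberProductStar β₁ β₂} (h₁ : z.fst ∈ C.φ₁.source)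
    (h₂ : z.snd ∈ C.φ₂.source) : C.φ₂ z.snd ≠ 0 := by
  intro h
  have h3 := C.coord_pow_eq h₁ h₂
  rw [h, zero_pow (mul_ne_zero C.n_ne_zero C.d_ne_zero)] at h3
  exact C.coord₁_ne_zero h₁ (pow_eq_zero_iff (mul_ne_zero C.m_ne_zero C.d_ne_zero) |>.1 h3)

/-- The invariant distinguishing the branches of the fibre product at `p`. -/
noncomputable def slope (z : FiberProductStar β₁ β₂) : ℂ := C.φ₂ z.snd ^ C.n / C.φ₁ z.fst ^ C.m

/-- The equation of the curve makes the slope a `d`-th root of unity. It is thus a continuous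
function with finitely many values, whose level sets are open. -/
theorem slope_pow {z : FiberProductStar β₁ β₂} (h₁ : z.fst ∈ C.φ₁.source)
    (h₂ : z.snd ∈ C.φ₂.source) : C.slope z ^ C.d = 1 := by
  rw [slope, div_pow, ← pow_mul, ← pow_mul, C.coord_pow_eq h₁ h₂]
  exact div_self (pow_ne_zero _ (C.coord₂_ne_zero h₁ h₂))

theorem finite_roots : {ω : ℂ | ω ^ C.d = 1}.Finite := by
  have h : {ω : ℂ | ω ^ C.d = 1} ⊆ (Polynomial.nthRoots C.d (1 : ℂ)).toFinset := by
    intro ω hω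
    rw [Finset.mem_coe, Multiset.mem_toFinset,
      Polynomial.mem_nthRoots (Nat.pos_of_ne_zero C.d_ne_zero)]
    exact hω
  exact (Finset.finite_toSet _).subset h

/-- The image of a branch of the fibre product at `p`. -/
def branch (ω : ℂ) : Set (FiberProductStar β₁ β₂) :=
  {z | (z.fst ∈ C.φ₁.source ∧ z.snd ∈ C.φ₂.source) ∧ ‖C.φ₁ z.fst‖ < C.ρ ^ C.n ∧ C.slope z = ω}

theorem isOpen_branch (ω : ℂ) : IsOpen (C.branch ω) := by
  set O : Set (FiberProductStar β₁ β₂) :=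
    {z | z.fst ∈ C.φ₁.source ∧ z.snd ∈ C.φ₂.source} with hO
  have hOo : IsOpen O := (C.φ₁.open_source.preimage continuous_fst).inter
    (C.φ₂.open_source.preimage continuous_snd)
  have hc₁ : ContinuousOn (fun z : FiberProductStar β₁ β₂ => C.φ₁ z.fst) O :=
    C.φ₁.continuousOn.comp continuous_fst.continuousOn fun z hz => hz.1
  have hc₂ : ContinuousOn (fun z : FiberProductStar β₁ β₂ => C.φ₂ z.snd) O :=
    C.φ₂.continuousOn.comp continuous_snd.continuousOn fun z hz => hz.2
  have hs : ContinuousOn C.slope O :=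
    (hc₂.pow _).div (hc₁.pow _) fun z hz => pow_ne_zero _ (C.coord₁_ne_zero hz.1)
  have h1 : IsOpen (O ∩ C.slope ⁻¹' ({η : ℂ | η ^ C.d = 1} \ {ω})ᶜ) :=
    hs.isOpen_inter_preimage hOo (C.finite_roots.subset Set.sdiff_subset).isClosed.isOpen_compl
  have h2 : IsOpen (O ∩ (fun z => ‖C.φ₁ z.fst‖) ⁻¹' Set.Iio (C.ρ ^ C.n)) :=
    hc₁.norm.isOpen_inter_preimage hOo isOpen_Iio
  convert h1.inter h2 using 1
  ext z
  constructor
  · rintro ⟨hz, hzn, hzω⟩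
    exact ⟨⟨hz, fun h => h.2 hzω⟩, hz, hzn⟩
  · rintro ⟨⟨hz, hzs⟩, -, hzn⟩
    refine ⟨hz, hzn, ?_⟩
    by_contra h
    exact hzs ⟨C.slope_pow hz.1 hz.2, h⟩

variable [ClosedRiemannSurface S₀] [ClosedRiemannSurface S₁] [ClosedRiemannSurface S₂]

/-- Every branch of the fibre product at `p` is a punctured disc. -/
theorem exists_param {ω : ℂ} (hω : ω ^ C.d = 1) :
    ∃ e : OpenPartialHomeomorph ℂ (FiberProductStar β₁ β₂),
      e.MDifferentiable 𝓘(ℂ, ℂ) 𝓘(ℂ, ℂ) ∧ e.source = Metric.ball 0 C.ρ \ {0} ∧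
      e.target = C.branch ω ∧ Filter.Tendsto (fun t => (e t).1) (𝓝[≠] 0) (𝓝 p) ∧
      ∀ t ∈ e.source, C.φ₁ (e t).fst = t ^ C.n := by
  classical
  -- On `t ↦ (t ^ n, ζ * t ^ m)` the slope is `ζ ^ n`, so `ζ` has to be an `n`-th root of `ω`.
  obtain ⟨ζ, hζω⟩ := IsAlgClosed.exists_pow_nat_eq ω (Nat.pos_of_ne_zero C.n_ne_zero)
  have hζd : (ζ ^ C.n) ^ C.d = 1 := by rw [hζω, hω]
  have hζn : ‖ζ‖ = 1 := Complex.norm_eq_one_of_pow_eq_one (n := C.n * C.d)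
    (by rw [pow_mul, hζd]) (mul_ne_zero C.n_ne_zero C.d_ne_zero)
  have hζ0 : ζ ≠ 0 := norm_ne_zero_iff.1 (by rw [hζn]; exact one_ne_zero)
  obtain ⟨a, b, hab⟩ : ∃ a b : ℤ, a * C.m + b * C.n = 1 :=
    Nat.isCoprime_iff_coprime.2 C.coprime
  have hmem := fun {t} (ht : t ∈ Metric.ball (0 : ℂ) C.ρ \ {0}) => C.pair_mem hζn hζd ht.1 ht.2
  -- The parameter `ρ / 2` only supplies a point `x₀` as the value of `f` outside the punctured
  -- disc.
  have hhalf : ((C.ρ / 2 : ℝ) : ℂ) ∈ Metric.ball (0 : ℂ) C.ρ \ {0} := by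
    refine ⟨?_, ?_⟩
    · rw [mem_ball_zero_iff, Complex.norm_real, Real.norm_of_nonneg (half_pos C.ρ_pos).le]
      exact half_lt_self C.ρ_pos
    · simpa using C.ρ_pos.ne'
  let x₀ : FiberProductStar β₁ β₂ := FiberProductStar.mk _ _ (hmem hhalf).1 (hmem hhalf).2
  set f : ℂ → FiberProductStar β₁ β₂ := fun t =>
    if h : t ∈ Metric.ball (0 : ℂ) C.ρ \ {0} then FiberProductStar.mk _ _ (hmem h).1 (hmem h).2 else x₀ with hf
  have hfv : ∀ t ∈ Metric.ball (0 : ℂ) C.ρ \ {0}, (f t).1 = C.pair ζ t := by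
    intro t ht
    simp only [hf]
    rw [dif_pos ht]
    rfl
  have hf₁ : ∀ t ∈ Metric.ball (0 : ℂ) C.ρ \ {0}, (f t).fst ∈ C.φ₁.source ∧
      C.φ₁ (f t).fst = t ^ C.n := by
    intro t ht
    have h1 : (f t).fst = C.φ₁.symm (t ^ C.n) := congrArg Prod.fst (hfv t ht)
    rw [h1, C.φ₁.right_inv (C.pow_mem_target₁ ht.1)]
    exact ⟨C.φ₁.map_target (C.pow_mem_target₁ ht.1), rfl⟩
  have hf₂ : ∀ t ∈ Metric.ball (0 : ℂ) C.ρ \ {0}, (f t).snd ∈ C.φ₂.source ∧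
      C.φ₂ (f t).snd = ζ * t ^ C.m := by
    intro t ht
    have h1 : (f t).snd = C.φ₂.symm (ζ * t ^ C.m) := congrArg Prod.snd (hfv t ht)
    rw [h1, C.φ₂.right_inv (C.mul_pow_mem_target₂ hζn ht.1)]
    exact ⟨C.φ₂.map_target (C.mul_pow_mem_target₂ hζn ht.1), rfl⟩
  -- The inverse of the parametrization, from Bézout coefficients of `m` and `n`.
  set g : FiberProductStar β₁ β₂ → ℂ := fun z => C.φ₁ z.fst ^ b * (C.φ₂ z.snd / ζ) ^ a with hg
  have hgz : ∀ z ∈ C.branch ω, g z ^ C.n = C.φ₁ z.fst ∧ ζ * g z ^ C.m = C.φ₂ z.snd := by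
    rintro z ⟨⟨h1, h2⟩, -, h3⟩
    refine zpow_mul_zpow_param hab hζ0 (C.coord₁_ne_zero h1) (C.coord₂_ne_zero h1 h2) ?_
    rw [hζω, ← h3, slope, div_mul_cancel₀ _ (pow_ne_zero _ (C.coord₁_ne_zero h1))]
  have hgs : ∀ z ∈ C.branch ω, g z ∈ Metric.ball (0 : ℂ) C.ρ \ {0} := by
    intro z hz
    have h1 := (hgz z hz).1
    refine ⟨?_, ?_⟩
    · rw [mem_ball_zero_iff]
      refine lt_of_pow_lt_pow_left₀ C.n C.ρ_pos.le ?_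
      rw [← norm_pow, h1]
      exact hz.2.1
    · intro h0
      rw [Set.mem_singleton_iff] at h0
      rw [h0, zero_pow C.n_ne_zero] at h1
      exact C.coord₁_ne_zero hz.1.1 h1.symm
  have hfc : ContinuousOn f (Metric.ball (0 : ℂ) C.ρ \ {0}) :=
    isInducing_val.continuousOn_iff.2
      (((C.continuousOn_pair hζn).mono Set.sdiff_subset).congr hfv)
  have hso : IsOpen (Metric.ball (0 : ℂ) C.ρ \ {0}) := Metric.isOpen_ball.sdiff isClosed_singleton
  let e : OpenPartialHomeomorph ℂ (FiberProductStar β₁ β₂) :=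
    { toFun := f
      invFun := g
      source := Metric.ball (0 : ℂ) C.ρ \ {0}
      target := C.branch ω
      map_source' := by
        intro t ht
        refine ⟨⟨(hf₁ t ht).1, (hf₂ t ht).1⟩, ?_, ?_⟩
        · rw [(hf₁ t ht).2, norm_pow]
          exact pow_lt_pow_left₀ (mem_ball_zero_iff.1 ht.1) (norm_nonneg _) C.n_ne_zero
        · rw [slope, (hf₁ t ht).2, (hf₂ t ht).2, mul_pow, hζω, ← pow_mul, ← pow_mul,
            mul_comm C.m, mul_div_cancel_right₀ _ (pow_ne_zero _ ht.2)]
      map_target' := hgs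
      left_inv' := by
        intro t ht
        simp only [hg]
        rw [(hf₁ t ht).2, (hf₂ t ht).2]
        exact zpow_mul_zpow_of_param hab hζ0 ht.2
      right_inv' := by
        intro z hz
        refine Subtype.ext ?_
        rw [hfv _ (hgs z hz), pair, (hgz z hz).1, (hgz z hz).2, C.φ₁.left_inv hz.1.1,
          C.φ₂.left_inv hz.1.2]
        rfl
      open_source := hso
      open_target := C.isOpen_branch ω
      continuousOn_toFun := hfc
      continuousOn_invFun := by
        have hc₁ : ContinuousOn (fun z : FiberProductStar β₁ β₂ => C.φ₁ z.fst) (C.branch ω) :=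
          C.φ₁.continuousOn.comp continuous_fst.continuousOn fun z hz => hz.1.1
        have hc₂ : ContinuousOn (fun z : FiberProductStar β₁ β₂ => C.φ₂ z.snd) (C.branch ω) :=
          C.φ₂.continuousOn.comp continuous_snd.continuousOn fun z hz => hz.1.2
        exact (hc₁.zpow₀ b fun z hz => Or.inl (C.coord₁_ne_zero hz.1.1)).mul
          ((hc₂.div_const ζ).zpow₀ a fun z hz =>
            Or.inl (div_ne_zero (C.coord₂_ne_zero hz.1.1 hz.1.2) hζ0)) }
  refine ⟨e, ⟨?_, ?_⟩, rfl, rfl, ?_, fun t ht => (hf₁ t ht).2⟩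
  · intro t ht
    refine MDifferentiableAt.mdifferentiableWithinAt ?_
    refine mdifferentiableAt_of_proj (hfc.continuousAt (hso.mem_nhds ht)) ?_
    have h1 : MDifferentiableAt 𝓘(ℂ, ℂ) 𝓘(ℂ, ℂ) (fun s : ℂ => s ^ C.n) t :=
      (differentiableAt_pow C.n).mdifferentiableAt
    have h2 := (β₁.holomorphic _).comp t
      ((C.mdifferentiable₁.mdifferentiableAt_symm (C.pow_mem_target₁ ht.1)).comp t h1)
    refine h2.congr_of_eventuallyEq ?_
    filter_upwards [hso.mem_nhds ht] with s hs
    exact congrArg (fun q : S₁ × S₂ => β₁ q.1) (hfv s hs)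
  · intro z hz
    refine MDifferentiableAt.mdifferentiableWithinAt ?_
    have hz' : z ∈ C.branch ω := hz
    have hp : MDifferentiable 𝓘(ℂ, ℂ) 𝓘(ℂ, ℂ) (fun s : ℂ => s ^ C.n) :=
      (differentiable_pow C.n).mdifferentiable
    -- On the branch, `g ^ n` is the holomorphic function `φ₁ ∘ fst`, and `s ↦ s ^ n` is a local
    -- biholomorphism at `g z ≠ 0`. The continuous function `g` is therefore holomorphic.
    obtain ⟨e', hx, he', hee'⟩ := hp.exists_localBiholomorphism (x := g z) (by
      rw [mfderiv_eq_fderiv]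
      intro h
      have h1 : deriv (fun s : ℂ => s ^ C.n) (g z) = 0 := by
        rw [← fderiv_apply_one_eq_deriv]
        exact congrArg (fun L : ℂ →L[ℂ] ℂ => L 1) h
      rw [deriv_pow_field] at h1
      exact mul_ne_zero (Nat.cast_ne_zero.2 C.n_ne_zero) (pow_ne_zero _ (hgs z hz').2) h1)
    refine mdifferentiableAt_of_localBiholomorphism_comp he' hx hee'
      (e.continuousAt_symm hz) ?_
    have h1 := (C.mdifferentiable₁.mdifferentiableAt hz'.1.1).comp z (mdifferentiable_fst z)
    refine h1.congr_of_eventuallyEq ?_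
    filter_upwards [(C.isOpen_branch ω).mem_nhds hz'] with w hw
    exact (hgz w hw).1
  · have h1 : Filter.Tendsto (C.pair ζ) (𝓝[≠] 0) (𝓝 p) := by
      have h2 := ((C.continuousOn_pair hζn).continuousAt
        (Metric.ball_mem_nhds (0 : ℂ) C.ρ_pos)).tendsto
      rw [C.pair_zero] at h2
      exact h2.mono_left nhdsWithin_le_nhds
    refine h1.congr' ?_
    filter_upwards [mem_nhdsWithin_of_mem_nhds (Metric.ball_mem_nhds (0 : ℂ) C.ρ_pos),
      self_mem_nhdsWithin] with t ht ht0
    exact (hfv t ⟨ht, ht0⟩).symm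

/-- The branches of the fibre product at `p` cover a punctured neighbourhood of `p`. -/
theorem exists_params :
    ∃ e : {ω : ℂ | ω ^ C.d = 1} → OpenPartialHomeomorph ℂ (FiberProductStar β₁ β₂),
      (∀ ω, (e ω).MDifferentiable 𝓘(ℂ, ℂ) 𝓘(ℂ, ℂ)) ∧ (∀ ω, 0 ∉ (e ω).source) ∧
      (∀ ω, (e ω).source ∈ 𝓝[≠] 0) ∧
      (∀ ω ω', ω ≠ ω' → Disjoint (Filter.map (e ω) (𝓝[≠] 0)) (Filter.map (e ω') (𝓝[≠] 0))) ∧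
      Filter.comap (fun z : FiberProductStar β₁ β₂ => z.1) (𝓝 p) =
        ⨆ ω, Filter.map (e ω) (𝓝[≠] 0) := by
  choose e he hs ht hlim hpow using fun ω : {ω : ℂ | ω ^ C.d = 1} => C.exists_param ω.2
  have hmem : ∀ ω, (e ω).source ∈ 𝓝[≠] (0 : ℂ) := fun ω => by
    rw [hs]
    exact sdiff_mem_nhdsWithin_compl (Metric.ball_mem_nhds (0 : ℂ) C.ρ_pos) _
  have hbr : ∀ ω, C.branch ω ∈ Filter.map (e ω) (𝓝[≠] 0) := fun ω => by
    refine Filter.mem_map.2 ?_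
    filter_upwards [hmem ω] with t htt
    rw [Set.mem_preimage, ← ht]
    exact (e ω).map_source htt
  refine ⟨e, he, fun ω => by simp [hs], hmem, fun ω ω' hne => ?_, le_antisymm ?_ ?_⟩
  · refine Filter.disjoint_iff.2 ⟨_, hbr ω, _, hbr ω', ?_⟩
    rw [Set.disjoint_left]
    rintro z ⟨-, -, h⟩ ⟨-, -, h'⟩
    exact hne (Subtype.ext (h.symm.trans h'))
  · intro A hA
    rw [Filter.mem_iSup] at hA
    have : Finite {ω : ℂ | ω ^ C.d = 1} := C.finite_roots
    have h1 : ∀ᶠ t in 𝓝[≠] (0 : ℂ), ∀ ω, e ω t ∈ A := Filter.eventually_all.2 hA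
    obtain ⟨δ, hδ, hδA⟩ := Metric.eventually_nhds_iff_ball.1 (eventually_nhdsWithin_iff.1 h1)
    -- A point `z` near `p` lies on the branch of its own slope, with a parameter `t` satisfying `t
    -- ^ n = φ₁ z.fst`. Bounding `φ₁` by the `n`-th power of `min δ ρ` thus gives `‖t‖ < δ`.
    have hc₁ : ∀ᶠ q : S₁ × S₂ in 𝓝 p, q.1 ∈ C.φ₁.source ∧ ‖C.φ₁ q.1‖ < (min δ C.ρ) ^ C.n := by
      have h2 : ∀ᶠ x in 𝓝 p.1, ‖C.φ₁ x‖ < (min δ C.ρ) ^ C.n := by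
        have h3 := (C.φ₁.continuousAt C.mem_source₁).norm
        refine h3.eventually_lt_const ?_
        simp only [C.apply₁, norm_zero]
        exact pow_pos (lt_min hδ C.ρ_pos) _
      exact _root_.continuous_fst.continuousAt.eventually
        ((C.φ₁.open_source.eventually_mem C.mem_source₁).and h2)
    have hc₂ : ∀ᶠ q : S₁ × S₂ in 𝓝 p, q.2 ∈ C.φ₂.source :=
      _root_.continuous_snd.continuousAt.eventually
        (C.φ₂.open_source.eventually_mem C.mem_source₂)
    refine Filter.mem_comap.2 ⟨_, hc₁.and hc₂, ?_⟩
    rintro z ⟨⟨hz₁, hzn⟩, hz₂⟩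
    let ω : {ω : ℂ | ω ^ C.d = 1} := ⟨C.slope z, C.slope_pow hz₁ hz₂⟩
    have hzt : z ∈ (e ω).target := by
      rw [ht]
      exact ⟨⟨hz₁, hz₂⟩, hzn.trans_le
        (pow_le_pow_left₀ (lt_min hδ C.ρ_pos).le (min_le_right _ _) _), rfl⟩
    have hts := (e ω).map_target hzt
    have h3 := hpow ω _ hts
    rw [(e ω).right_inv hzt] at h3
    have hlt : ‖(e ω).symm z‖ < δ := by
      refine lt_of_pow_lt_pow_left₀ C.n hδ.le ?_
      rw [← norm_pow, ← h3]
      exact hzn.trans_le (pow_le_pow_left₀ (lt_min hδ C.ρ_pos).le (min_le_left _ _) _)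
    have hne : (e ω).symm z ≠ 0 := by
      rw [hs] at hts
      exact hts.2
    have h4 := hδA _ (mem_ball_zero_iff.2 hlt) hne ω
    rwa [(e ω).right_inv hzt] at h4
  · refine iSup_le fun ω => ?_
    rw [← Filter.map_le_iff_le_comap, Filter.map_map]
    exact hlim ω

end CrossingCoordinates

section Ends

variable [ClosedRiemannSurface S₀] [ClosedRiemannSurface S₁] [ClosedRiemannSurface S₂]
  {β₁ : HolomorphicMap S₁ S₀} {β₂ : HolomorphicMap S₂ S₀}

/-- The whole fibre product is compact, and the unbranched part is what remains after removing the
points over the branch set. Leaving every compact set therefore means approaching one of these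
points. -/
theorem cocompact_eq :
    Filter.cocompact (FiberProductStar β₁ β₂) =
      ⨆ p : {p : S₁ × S₂ | p ∈ fiberProduct β₁ β₂ ∧ β₁ p.1 ∈ branchSet β₁ β₂},
        Filter.comap (fun z : FiberProductStar β₁ β₂ => z.1) (𝓝 p.1) := by
  refine le_antisymm ?_ ?_
  · intro A hA
    rw [Filter.mem_iSup] at hA
    have h1 : ∀ p : {p : S₁ × S₂ | p ∈ fiberProduct β₁ β₂ ∧ β₁ p.1 ∈ branchSet β₁ β₂},
        ∃ N : Set (S₁ × S₂), p.1 ∈ N ∧ IsOpen N ∧ ∀ z : FiberProductStar β₁ β₂, z.1 ∈ N → z ∈ A := by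
      intro p
      obtain ⟨N, hN, hNA⟩ := Filter.mem_comap.1 (hA p)
      obtain ⟨N', hN'N, hN', hp⟩ := mem_nhds_iff.1 hN
      exact ⟨N', hp, hN', fun z hz => hNA (hN'N hz)⟩
    choose N hpN hNo hNA using h1
    have hK : IsCompact (fiberProduct β₁ β₂ \ ⋃ p, N p) :=
      (isClosed_fiberProduct.sdiff (isOpen_iUnion hNo)).isCompact
    have hKr : fiberProduct β₁ β₂ \ ⋃ p, N p ⊆
        Set.range (fun z : FiberProductStar β₁ β₂ => z.1) := by
      rintro z ⟨hz, hzN⟩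
      refine ⟨⟨z, hz, fun h => hzN (Set.mem_iUnion.2 ⟨⟨z, hz, h⟩, hpN _⟩)⟩, rfl⟩
    refine Filter.mem_cocompact.2 ⟨_, (isInducing_val.isCompact_preimage_iff hKr).2 hK, ?_⟩
    intro z hz
    by_contra hzA
    refine hz ⟨z.2.1, fun h => ?_⟩
    obtain ⟨p, hp⟩ := Set.mem_iUnion.1 h
    exact hzA (hNA p z hp)
  · refine iSup_le fun p A hA => ?_
    obtain ⟨K, hK, hKA⟩ := Filter.mem_cocompact.1 hA
    have hKc : IsClosed ((fun z : FiberProductStar β₁ β₂ => z.1) '' K) :=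
      (hK.image isInducing_val.continuous).isClosed
    refine Filter.mem_comap.2 ⟨_, hKc.isOpen_compl.mem_nhds ?_, ?_⟩
    · rintro ⟨z, -, hz⟩
      have hz' : z.1 = p.1 := hz
      exact z.2.2 (by rw [hz']; exact p.2.2)
    · exact fun z hz => hKA fun hzK => hz ⟨z, hzK, rfl⟩

theorem finite_setOf_mem_branchSet (hβ₁ : β₁.Nonconstant) (hβ₂ : β₂.Nonconstant) :
    {p : S₁ × S₂ | p ∈ fiberProduct β₁ β₂ ∧ β₁ p.1 ∈ branchSet β₁ β₂}.Finite := by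
  have hB := finite_branchSet hβ₁ hβ₂
  refine ((hβ₁.finite_preimage hB).prod (hβ₂.finite_preimage hB)).subset ?_
  rintro p ⟨hp, hpB⟩
  have hp' : β₁ p.1 = β₂ p.2 := hp
  exact ⟨hpB, by rwa [hp'] at hpB⟩

/-- The unbranched part of the fibre product has finitely many ends, all of them punctured
discs. -/
theorem exists_puncturedEnds (hβ₁ : β₁.Nonconstant) (hβ₂ : β₂.Nonconstant) :
    ∃ J : Type (max u₁ u₂), Finite J ∧ Nonempty (PuncturedEnds (FiberProductStar β₁ β₂) J) := by
  have C := fun p : {p : S₁ × S₂ | p ∈ fiberProduct β₁ β₂ ∧ β₁ p.1 ∈ branchSet β₁ β₂} =>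
    (nonempty_crossingCoordinates hβ₁ hβ₂ p.2.1 p.2.2).some
  choose e he h0 hs hd hcomap using fun p => (C p).exists_params
  have : Finite {p : S₁ × S₂ | p ∈ fiberProduct β₁ β₂ ∧ β₁ p.1 ∈ branchSet β₁ β₂} :=
    finite_setOf_mem_branchSet hβ₁ hβ₂
  have : ∀ p, Finite {ω : ℂ | ω ^ (C p).d = 1} := fun p => (C p).finite_roots
  have hle : ∀ p ω, Filter.map (e p ω) (𝓝[≠] 0) ≤
      Filter.comap (fun z : FiberProductStar β₁ β₂ => z.1) (𝓝 p.1) := fun p ω =>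
    (le_iSup (fun ω => Filter.map (e p ω) (𝓝[≠] 0)) ω).trans (hcomap p).ge
  -- An end is a point over the branch set together with one of the `d` slopes there. Ends at
  -- different points are separated because `S₁ × S₂` is Hausdorff.
  refine ⟨Σ p, {ω : ℂ | ω ^ (C p).d = 1}, inferInstance, ⟨{
    param := fun j => e j.1 j.2
    mdifferentiable := fun j => he j.1 j.2
    zero_notMem := fun j => h0 j.1 j.2
    source_mem := fun j => hs j.1 j.2
    disjoint := ?_
    cocompact := ?_ }⟩⟩
  · rintro ⟨p, ω⟩ ⟨p', ω'⟩ hne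
    by_cases hp : p = p'
    · subst hp
      exact hd p ω ω' fun h => hne (by rw [h])
    · have h1 : Disjoint (𝓝 p.1) (𝓝 p'.1) := disjoint_nhds_nhds.2 fun h => hp (Subtype.ext h)
      exact (Filter.disjoint_comap h1).mono (hle p ω) (hle p' ω')
  · rw [cocompact_eq, iSup_sigma]
    exact iSup_congr hcomap

/-- All ends are filled in at once, which gives a compact surface that may be disconnected; its
component through `x` is the completion. -/
theorem exists_isPunctureCompactification (hβ₁ : β₁.Nonconstant) (hβ₂ : β₂.Nonconstant)
    (x : FiberProductStar β₁ β₂) :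
    ∃ (R : Type (max u₁ u₂)) (_ : TopologicalSpace R) (_ : ChartedSpace ℂ R),
      ClosedRiemannSurface R ∧ IsPunctureCompactification (component x) R := by
  obtain ⟨J, hJ, ⟨E⟩⟩ := exists_puncturedEnds hβ₁ hβ₂
  refine exists_isPunctureCompactification_component E.isOpenEmbedding_incl E.mdifferentiable_incl
    ?_ x _ rfl
  rw [E.compl_range_incl]
  exact Set.finite_range _

end Ends

end FiberProductStar

/-! ### The main theorem -/

theorem corollary2p4
    {S₀ : Type u₀} [TopologicalSpace S₀] [ChartedSpace ℂ S₀] [ClosedRiemannSurface S₀]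
    {S₁ : Type u₁} [TopologicalSpace S₁] [ChartedSpace ℂ S₁] [ClosedRiemannSurface S₁]
    {S₂ : Type u₂} [TopologicalSpace S₂] [ChartedSpace ℂ S₂] [ClosedRiemannSurface S₂]
    (β₁ : HolomorphicMap S₁ S₀) (hβ₁ : β₁.Nonconstant)
    (β₂ : HolomorphicMap S₂ S₀) (hβ₂ : β₂.Nonconstant) :
    -- If `β₁` or `β₂` is regular, then every component `T_k` can be completed to a closed Riemann
    -- surface, and all irreducible components so obtained are isomorphic.
    ((IsRegularBranchedCover β₁ ∨ IsRegularBranchedCover β₂) →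
      (∀ x : FiberProductStar β₁ β₂,
        ∃ (R : Type (max u₁ u₂)) (_ : TopologicalSpace R) (_ : ChartedSpace ℂ R),
          ClosedRiemannSurface R ∧
            IsPunctureCompactification (FiberProductStar.component x) R) ∧
      ∀ (R : Type v) [TopologicalSpace R] [ChartedSpace ℂ R]
        (R' : Type v') [TopologicalSpace R'] [ChartedSpace ℂ R'],
        IsIrreducibleComponent β₁ β₂ R → IsIrreducibleComponent β₁ β₂ R' →
          Biholomorphic R R') ∧
    -- The group form: `U` is the universal cover of the unbranched part of `S₀`, with deck group
    -- `Γ₀`, and the unbranched coverings given by `β₁`, `β₂` are `U / Γ₁ → U / Γ₀`, `U / Γ₂ → U / Γ₀`.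
    (∀ (U : Type w) [TopologicalSpace U] [ChartedSpace ℂ U] [RiemannSurface U]
        [SimplyConnectedSpace U] (Γ₀ : Type w') [Group Γ₀] [MulAction Γ₀ U]
        (Γ₁ Γ₂ : Subgroup Γ₀)
        (p₀ : HolomorphicMap U S₀) (p₁ : HolomorphicMap U S₁) (p₂ : HolomorphicMap U S₂),
        RealizesQuotient Γ₀ p₀ (branchSet β₁ β₂)ᶜ →
        RealizesQuotient Γ₁ p₁ (β₁ ⁻¹' (branchSet β₁ β₂)ᶜ) →
        RealizesQuotient Γ₂ p₂ (β₂ ⁻¹' (branchSet β₁ β₂)ᶜ) →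
        (∀ u, β₁ (p₁ u) = p₀ u) → (∀ u, β₂ (p₂ u) = p₀ u) →
        (Γ₁.Normal ∨ Γ₂.Normal) →
        ∀ x y : FiberProductStar β₁ β₂,
          Biholomorphic (FiberProductStar.component x) (FiberProductStar.component y)) := by
  have hcomp : (IsRegularBranchedCover β₁ ∨ IsRegularBranchedCover β₂) →
      ∀ x y : FiberProductStar β₁ β₂,
        Biholomorphic (FiberProductStar.component x) (FiberProductStar.component y) := by
    rintro (h | h)
    · exact FiberProductStar.biholomorphic_of_hasTransitiveDeckMaps_fst hβ₁ hβ₂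
        (h.hasTransitiveDeckMaps _)
    · exact FiberProductStar.biholomorphic_of_hasTransitiveDeckMaps_snd hβ₁ hβ₂
        (h.hasTransitiveDeckMaps _)
  refine ⟨fun hreg => ⟨FiberProductStar.exists_isPunctureCompactification hβ₁ hβ₂, ?_⟩, ?_⟩
  · rintro R _ _ R' _ _ ⟨hR, x, hx⟩ ⟨hR', y, hy⟩
    exact hx.biholomorphic hy (hcomp hreg x y)
  · rintro U _ _ _ _ Γ₀ _ _ Γ₁ Γ₂ p₀ p₁ p₂ h₀ h₁ h₂ hp₁ hp₂ (hN | hN)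
    · exact FiberProductStar.biholomorphic_of_hasTransitiveDeckMaps_fst hβ₁ hβ₂
        (h₀.hasTransitiveDeckMaps hN h₁ hp₁)
    · exact FiberProductStar.biholomorphic_of_hasTransitiveDeckMaps_snd hβ₁ hβ₂
        (h₀.hasTransitiveDeckMaps hN h₂ hp₂)
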